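/- Let $\mathcal C$ be a unitary fusion category, that is, a $\mathbb C$-linear semisimple abelian rigid monoidal category with finite-dimensional morphism spaces, finitely many isomorphism classes of simple objects, simple unit object and bilinear tensor product, equipped with an antilinear, involutive, contravariant, identity-on-objects dagger $f\mapsto f^\dagger$ such that every $f^\dagger f$ is positive (of the form $g^\dagger g$ with $g$ an endomorphism), $f^\dagger f=0$ only if $f=0$, $(f\otimes g)^\dagger=f^\dagger\otimes g^\dagger$, and the associators and unitors are unitary. Let $x_0,\dots,x_r$ be representatives of the isomorphism classes of simple objects, let $N_j$ be the fusion matrix of $x_j$, with entries $(N_j)_{l,k}=\dim\operatorname{Hom}(x_j\otimes x_k,x_l)$, and let $d_j>0$ be the quantum dimension of $x_j$, i.e. the common value $\mathrm{coev}^\dagger\,\mathrm{coev}=\mathrm{ev}\,\mathrm{ev}^\dagger=d_j\,\mathrm{id}_{\mathbf 1}$ of the two loops of a duality pairing $\mathrm{coev}:\mathbf 1\to x_j\otimes \overline{x_j}$, $\mathrm{ev}:\overline{x_j}\otimes x_j\to\mathbf 1$ normalized so that the two loops agree. Then for every $n\in\mathbb N$ (including $n=0$) $$\sum_{j=0}^r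 d_j^{-n+2}\,N_j^{\otimes n}\ \ge 0,$$ i.e. this matrix, where $N_j^{\otimes n}$ is the $n$-fold Kronecker power, is positive semidefinite. Moreover, let $\mathcal M$ be a unitary (left) module category over $\mathcal C$, that is, a $\mathbb C$-linear semisimple abelian category with finite-dimensional morphism spaces and finitely many isomorphism classes of simple objects, represented by $m_0,\dots,m_s$, with a dagger that is positive in the same sense, and with a bilinear action $\mathcal C\times\mathcal M\to\mathcal M$ compatible with the daggers and with unitary associativity and unit constraints. Then for every $n\in\mathbb N$ the same inequality $\sum_{j=0}^r d_j^{-n+2}N_j^{\otimes n}\ge 0$ holds with $N_j$ replaced by the matrix of $x_j$ acting on $K_0(\mathcal M)$, with entries $(N_j)_{l,k}=\dim\operatorname{Hom}(x_j\cdot m_k,m_l)$. -/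

import Mathlib

open CategoryTheory MonoidalCategory Limits
open scoped ComplexConjugate ComplexOrder

universe v u v' u'

/-- A dagger structure: an involutive contravariant functor that is the identity on objects. -/
class DaggerCategory (C : Type u) [Category.{v} C] where
  /-- The adjoint `f† : Y ⟶ X` of `f : X ⟶ Y`. -/
  dag {X Y : C} (f : X ⟶ Y) : Y ⟶ X
  dag_id (X : C) : dag (𝟙 X) = 𝟙 X
  dag_comp {X Y Z : C} (f : X ⟶ Y) (g : Y ⟶ Z) : dag (f ≫ g) = dag g ≫ dag f
  dag_dag {X Y : C} (f : X ⟶ Y) : dag (dag f) = f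

open DaggerCategory (dag)

/-- A unitary category: a semisimple `ℂ`-linear abelian category with finite-dimensional hom
spaces and an antilinear dagger that makes it a C*-category. Since all hom spaces are
finite-dimensional, the C*-condition amounts to: every `f† ∘ f` (written `f ≫ dag f`) is a
positive element `g† ∘ g` of the endomorphism algebra, and it vanishes only if `f = 0`. -/
class UnitaryCategory (C : Type u) [Category.{v} C] [Abelian C] [Linear ℂ C] extends
    DaggerCategory C where
  finiteDimensional_hom (X Y : C) : FiniteDimensional ℂ (X ⟶ Y)
  semisimple (X : C) : ∃ (k : ℕ) (S : Fin k → C) (b : Bicone S),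
    (∀ i, Simple (S i)) ∧ Nonempty b.IsBilimit ∧ Nonempty (b.pt ≅ X)
  dag_add {X Y : C} (f g : X ⟶ Y) : dag (f + g) = dag f + dag g
  dag_smul {X Y : C} (c : ℂ) (f : X ⟶ Y) : dag (c • f) = conj c • dag f
  dag_positive {X Y : C} (f : X ⟶ Y) : ∃ g : X ⟶ X, f ≫ dag f = g ≫ dag g
  dag_definite {X Y : C} (f : X ⟶ Y) : f ≫ dag f = 0 → f = 0

/-- `x` lists the simple objects of `C`, exactly one from each isomorphism class. -/
structure IsSimpleList {C : Type u} [Category.{v} C] [Abelian C] {ι : Type*} (x : ι → C) :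
    Prop where
  simple (i : ι) : Simple (x i)
  irredundant (i j : ι) : Nonempty (x i ≅ x j) → i = j
  complete (S : C) : Simple S → ∃ i, Nonempty (S ≅ x i)

/-- A unitary fusion category: a unitary category that is rigid monoidal with bilinear tensor
product, simple unit and finitely many simple objects up to isomorphism, whose tensor product
is compatible with the dagger and whose associators and unitors are unitary. -/
class UnitaryFusionCategory (C : Type u) [Category.{v} C] [Abelian C] [Linear ℂ C]
    [MonoidalCategory C] [MonoidalPreadditive C] [MonoidalLinear ℂ C] [RigidCategory C]
    [UnitaryCategory C] : Prop where
  simple_unit : Simple (𝟙_ C)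
  finite_simples : ∃ (k : ℕ) (x : Fin k → C), IsSimpleList x
  dag_tensorHom {X Y X' Y' : C} (f : X ⟶ Y) (g : X' ⟶ Y') :
    dag (f ⊗ₘ g) = dag f ⊗ₘ dag g
  dag_associator (X Y Z : C) : dag (α_ X Y Z).hom = (α_ X Y Z).inv
  dag_leftUnitor (X : C) : dag (λ_ X).hom = (λ_ X).inv
  dag_rightUnitor (X : C) : dag (ρ_ X).hom = (ρ_ X).inv

open scoped MonoidalLeftAction in
/-- A unitary (left) module category over `C`: a unitary category `M` with a bilinear action
`C × M → M` that is compatible with the daggers and has unitary associativity and unit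
constraints. -/
class UnitaryModuleCategory (C : Type u) [Category.{v} C] [Abelian C] [Linear ℂ C]
    [MonoidalCategory C] [DaggerCategory C] (M : Type u') [Category.{v'} M] [Abelian M]
    [Linear ℂ M] [UnitaryCategory M] [MonoidalLeftAction C M] : Prop where
  add_actionHomLeft {X Y : C} (f g : X ⟶ Y) (m : M) : (f + g) ⊵ₗ m = f ⊵ₗ m + g ⊵ₗ m
  smul_actionHomLeft {X Y : C} (c : ℂ) (f : X ⟶ Y) (m : M) : (c • f) ⊵ₗ m = c • (f ⊵ₗ m)
  actionHomRight_add (X : C) {m m' : M} (f g : m ⟶ m') : X ⊴ₗ (f + g) = X ⊴ₗ f + X ⊴ₗ g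
  actionHomRight_smul (X : C) {m m' : M} (c : ℂ) (f : m ⟶ m') :
    X ⊴ₗ (c • f) = c • (X ⊴ₗ f)
  dag_actionHomLeft {X Y : C} (f : X ⟶ Y) (m : M) : dag (f ⊵ₗ m) = dag f ⊵ₗ m
  dag_actionHomRight (X : C) {m m' : M} (f : m ⟶ m') : dag (X ⊴ₗ f) = X ⊴ₗ dag f
  dag_actionAssocIso (X Y : C) (m : M) : dag (αₗ X Y m).hom = (αₗ X Y m).inv
  dag_actionUnitIso (m : M) : dag (λₗ[C] m).hom = (λₗ[C] m).inv

/-- The quantum dimension of `X`: the least value `d` of the two closed loops `coev† ∘ coev` and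
`ev ∘ ev†`, over all duality pairings of `X` normalized so that the two loops agree. In a unitary
fusion category this is the categorical dimension for the canonical (unitary) spherical structure;
for simple `X` all normalized pairings give the same `d`. -/
noncomputable def quantumDim {C : Type u} [Category.{v} C] [Abelian C] [Linear ℂ C]
    [MonoidalCategory C] [DaggerCategory C] (X : C) : ℝ :=
  sInf {d : ℝ | ∃ (Y : C) (_ : ExactPairing X Y),
    η_ X Y ≫ dag (η_ X Y) = (d : ℂ) • 𝟙 (𝟙_ C) ∧
    dag (ε_ X Y) ≫ ε_ X Y = (d : ℂ) • 𝟙 (𝟙_ C)}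

/-- The fusion matrix of `X` on the basis `x` of `K₀(C)`: the column of `x k` holds the
multiplicities of the simple objects `x l` in `X ⊗ x k`. -/
noncomputable def fusionMatrix {C : Type u} [Category.{v} C] [Abelian C] [Linear ℂ C]
    [MonoidalCategory C] {ι : Type*} (x : ι → C) (X : C) : Matrix ι ι ℂ :=
  Matrix.of fun l k => (Module.finrank ℂ (X ⊗ x k ⟶ x l) : ℂ)

open scoped MonoidalLeftAction in
/-- The fusion matrix of `X : C` on the basis `m` of `K₀(M)`: the column of `m k` holds the
multiplicities of the simple objects `m l` in `X ⊙ₗ m k`. -/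
noncomputable def moduleFusionMatrix {C : Type u} [Category.{v} C] [MonoidalCategory C]
    {M : Type u'} [Category.{v'} M] [Abelian M] [Linear ℂ M] [MonoidalLeftAction C M]
    {κ : Type*} (m : κ → M) (X : C) : Matrix κ κ ℂ :=
  Matrix.of fun l k => (Module.finrank ℂ (X ⊙ₗ m k ⟶ m l) : ℂ)

/-- The `n`-fold Kronecker power `A ⊗ ⋯ ⊗ A`, indexed by `n`-tuples. -/
def kroneckerPow {ι : Type*} (A : Matrix ι ι ℂ) (n : ℕ) : Matrix (Fin n → ι) (Fin n → ι) ℂ :=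
  Matrix.of fun a b => ∏ i, A (a i) (b i)

set_option linter.unusedSectionVars false

attribute [instance] UnitaryCategory.finiteDimensional_hom

lemma hom_eq_zero_of_not_iso {D : Type u} [Category.{v} D] [Abelian D] {k l : D} [Simple k]
    [Simple l] (h : ¬ Nonempty (k ≅ l)) (f : k ⟶ l) :
    f = 0 := by
  by_contra hf
  have := isIso_of_hom_simple hf
  exact h ⟨asIso f⟩

section UnitaryCategory

open UnitaryCategory DaggerCategory

variable {D : Type u} [Category.{v} D] [Abelian D] [Linear ℂ D] [UnitaryCategory D]

lemma dag_zero (X Y : D) : dag (0 : X ⟶ Y) = 0 := by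
  have := dag_smul (0 : ℂ) (0 : X ⟶ Y)
  simpa using this

lemma dag_sum {X Y : D} {I : Type*} (s : Finset I) (f : I → (X ⟶ Y)) :
    dag (∑ i ∈ s, f i) = ∑ i ∈ s, dag (f i) := by
  classical
  induction s using Finset.induction_on with
  | empty => simp [dag_zero]
  | insert a s ha ih => simp [Finset.sum_insert ha, dag_add, ih]

/-- The scalar by which an endomorphism of a simple object acts. -/
noncomputable def schurScalar (k : D) [Simple k] : (k ⟶ k) →ₗ[ℂ] ℂ where
  toFun f := (endomorphism_simple_eq_smul_id ℂ f).choose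
  map_add' f g := by
    apply smul_left_injective ℂ (id_nonzero k)
    dsimp only
    rw [add_smul, (endomorphism_simple_eq_smul_id ℂ f).choose_spec,
      (endomorphism_simple_eq_smul_id ℂ g).choose_spec,
      (endomorphism_simple_eq_smul_id ℂ (f + g)).choose_spec]
  map_smul' c f := by
    apply smul_left_injective ℂ (id_nonzero k)
    dsimp only
    rw [RingHom.id_apply, smul_assoc, (endomorphism_simple_eq_smul_id ℂ f).choose_spec,
      (endomorphism_simple_eq_smul_id ℂ (c • f)).choose_spec]

lemma schurScalar_smul_id {k : D} [Simple k] (f : k ⟶ k) : schurScalar k f • 𝟙 k = f :=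
  (endomorphism_simple_eq_smul_id ℂ f).choose_spec

lemma schurScalar_eq {k : D} [Simple k] {f : k ⟶ k} {c : ℂ} (h : f = c • 𝟙 k) :
    schurScalar k f = c :=
  smul_left_injective ℂ (id_nonzero k) ((schurScalar_smul_id f).trans h)

@[simp] lemma schurScalar_id (k : D) [Simple k] : schurScalar k (𝟙 k) = 1 :=
  schurScalar_eq (one_smul _ _).symm

lemma schurScalar_comp {k : D} [Simple k] (f g : k ⟶ k) :
    schurScalar k (f ≫ g) = schurScalar k f * schurScalar k g := by
  apply schurScalar_eq
  conv_lhs => rw [← schurScalar_smul_id f, ← schurScalar_smul_id g]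
  simp [smul_smul]
  ring_nf

lemma schurScalar_dag {k : D} [Simple k] (f : k ⟶ k) :
    schurScalar k (dag f) = conj (schurScalar k f) := by
  apply schurScalar_eq
  conv_lhs => rw [← schurScalar_smul_id f, dag_smul, dag_id]

lemma schurScalar_comp_dag_nonneg {k X : D} [Simple k] (f : k ⟶ X) :
    0 ≤ schurScalar k (f ≫ dag f) := by
  obtain ⟨g, hg⟩ := dag_positive f
  rw [hg, schurScalar_comp, schurScalar_dag, Complex.mul_conj]
  exact_mod_cast Complex.normSq_nonneg _

lemma schurScalar_dag_comp_nonneg {k X : D} [Simple k] (f : X ⟶ k) :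
    0 ≤ schurScalar k (dag f ≫ f) := by
  simpa [dag_dag] using schurScalar_comp_dag_nonneg (dag f)

lemma schurScalar_comp_dag_eq_zero {k X : D} [Simple k] {f : k ⟶ X}
    (h : schurScalar k (f ≫ dag f) = 0) : f = 0 := by
  apply dag_definite
  rw [← schurScalar_smul_id (f ≫ dag f), h, zero_smul]

lemma schurScalar_dag_comp_eq_zero {k X : D} [Simple k] {f : X ⟶ k}
    (h : schurScalar k (dag f ≫ f) = 0) : f = 0 := by
  have := schurScalar_comp_dag_eq_zero (f := dag f) (by rwa [dag_dag])
  rw [← dag_dag f, this, dag_zero]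

/-- The inner product `⟪f, g⟫ = g ∘ f†` on the morphisms into a simple object. -/
@[reducible]
noncomputable def homInnerCore (X k : D) [Simple k] : InnerProductSpace.Core ℂ (X ⟶ k) where
  inner f g := schurScalar k (dag f ≫ g)
  conj_inner_symm f g := by
    rw [← schurScalar_dag, dag_comp, dag_dag]
  re_inner_nonneg f := (Complex.le_def.1 (schurScalar_dag_comp_nonneg f)).1
  add_left f g h := by simp [dag_add]
  smul_left f g c := by simp [dag_smul]
  definite f h := schurScalar_dag_comp_eq_zero h

lemma exists_orthonormal_hom_basis (X k : D) [Simple k] :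
    ∃ u : Fin (Module.finrank ℂ (X ⟶ k)) → (X ⟶ k),
      (∀ i j, dag (u i) ≫ u j = if i = j then 𝟙 k else 0) ∧
      ∀ f : X ⟶ k, ∑ i, u i ≫ dag (u i) ≫ f = f := by
  let c := homInnerCore X k
  let : NormedAddCommGroup (X ⟶ k) := c.toNormedAddCommGroup
  let : InnerProductSpace ℂ (X ⟶ k) := InnerProductSpace.ofCore c.toCore
  have hin : ∀ f g : X ⟶ k, inner ℂ f g = schurScalar k (dag f ≫ g) := fun _ _ => rfl
  let b := stdOrthonormalBasis ℂ (X ⟶ k)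
  refine ⟨fun i => b i, fun i j => ?_, fun f => ?_⟩
  · rw [← schurScalar_smul_id (dag (b i) ≫ b j), ← hin,
      orthonormal_iff_ite.1 b.orthonormal i j]
    split_ifs <;> simp
  · conv_rhs => rw [← b.sum_repr' f]
    refine Finset.sum_congr rfl fun i _ => ?_
    rw [hin, ← schurScalar_smul_id (dag (b i) ≫ f)]
    simp

/-- A chosen orthonormal basis of the space of morphisms from `X` to a simple object. -/
noncomputable def onb (X k : D) [Simple k] : Fin (Module.finrank ℂ (X ⟶ k)) → (X ⟶ k) :=
  (exists_orthonormal_hom_basis X k).choose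

lemma dag_onb_comp_onb (X k : D) [Simple k] (i j) :
    dag (onb X k i) ≫ onb X k j = if i = j then 𝟙 k else 0 :=
  (exists_orthonormal_hom_basis X k).choose_spec.1 i j

lemma sum_onb_comp {X k : D} [Simple k] (f : X ⟶ k) :
    ∑ i, onb X k i ≫ dag (onb X k i) ≫ f = f :=
  (exists_orthonormal_hom_basis X k).choose_spec.2 f

lemma sum_comp_onb {X k : D} [Simple k] (f : k ⟶ X) :
    ∑ i, (f ≫ onb X k i) ≫ dag (onb X k i) = f := by
  have := congrArg dag (sum_onb_comp (dag f))
  simpa [dag_sum, dag_comp, dag_dag] using this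

lemma hom_ext_simple {X Y : D} {f g : Y ⟶ X}
    (h : ∀ (S : D) [Simple S] (p : X ⟶ S), f ≫ p = g ≫ p) : f = g := by
  obtain ⟨n, S, b, hS, ⟨hb⟩, ⟨e⟩⟩ := semisimple X
  rw [← cancel_mono e.inv]
  refine hb.isLimit.hom_ext fun ⟨i⟩ => ?_
  have := hS i
  simpa using h (S i) (e.inv ≫ b.π i)

variable {ι : Type*} {x : ι → D}

lemma dag_onb_comp_onb_of_ne (hx : IsSimpleList x) [∀ i, Simple (x i)] (X : D) {p q : ι}
    (h : p ≠ q) (i j) : dag (onb X (x p) i) ≫ onb X (x q) j = 0 :=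
  hom_eq_zero_of_not_iso (fun e => h (hx.irredundant p q e)) _

lemma eq_id_of_forall_comp (hx : IsSimpleList x) {X : D} {e : X ⟶ X}
    (h : ∀ p (f : X ⟶ x p), e ≫ f = f) : e = 𝟙 X := by
  refine hom_ext_simple fun S _ f => ?_
  obtain ⟨p, ⟨i⟩⟩ := hx.complete S ‹_›
  rw [← cancel_mono i.hom, Category.id_comp, Category.assoc]
  exact h p _

variable [Fintype ι]

lemma sum_comp_dag_eq_id (hx : IsSimpleList x) [∀ i, Simple (x i)] {X : D} {n : ι → ℕ}
    {σ : ι → ι} (hσ : Function.Bijective σ) (v : (p : ι) → Fin (n p) → (X ⟶ x (σ p))) (c : ι → ℂ)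
    (h : ∀ p (f : X ⟶ x (σ p)), c p • ∑ i, v p i ≫ dag (v p i) ≫ f = f) :
    ∑ p, c p • ∑ i, v p i ≫ dag (v p i) = 𝟙 X := by
  classical
  refine eq_id_of_forall_comp hx fun p f => ?_
  obtain ⟨p, rfl⟩ := hσ.surjective p
  rw [Preadditive.sum_comp, Finset.sum_eq_single p]
  · simp only [Linear.smul_comp, Preadditive.sum_comp, Category.assoc]
    exact h p f
  · intro q _ hq
    rw [Linear.smul_comp, Preadditive.sum_comp, Finset.sum_eq_zero, smul_zero]
    intro i _
    rw [Category.assoc, hom_eq_zero_of_not_iso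
      (fun h => hq (hσ.injective (hx.irredundant _ _ h))) (dag (v q i) ≫ f), comp_zero]
  · simp

lemma sum_onb_comp_dag_onb (hx : IsSimpleList x) [∀ i, Simple (x i)] (X : D) :
    ∑ p, ∑ i, onb X (x p) i ≫ dag (onb X (x p) i) = 𝟙 X := by
  have := sum_comp_dag_eq_id hx Function.bijective_id (fun p => onb X (x p)) (fun _ => 1)
    (fun p f => by rw [one_smul]; exact sum_onb_comp f)
  simpa using this

variable {E : Type u'} [Category.{v'} E] [Abelian E] [Linear ℂ E]
  [∀ Y Y' : E, FiniteDimensional ℂ (Y ⟶ Y')]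

lemma finrank_hom_obj (hx : IsSimpleList x) (G : D ⥤ E) [G.Additive]
    [G.Linear ℂ] (X : D) (Y : E) :
    Module.finrank ℂ (G.obj X ⟶ Y) =
      ∑ p, Module.finrank ℂ (X ⟶ x p) * Module.finrank ℂ (G.obj (x p) ⟶ Y) := by
  classical
  have := hx.simple
  let e : (G.obj X ⟶ Y) ≃ₗ[ℂ]
      ((p : ι) → Fin (Module.finrank ℂ (X ⟶ x p)) → (G.obj (x p) ⟶ Y)) :=
    { toFun := fun f p i => G.map (dag (onb X (x p) i)) ≫ f
      map_add' := fun f g => by ext; simp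
      map_smul' := fun c f => by ext; simp
      invFun := fun f => ∑ p, ∑ i, G.map (onb X (x p) i) ≫ f p i
      left_inv := fun f => by
        dsimp only
        simp only [← Category.assoc, ← G.map_comp, ← Preadditive.sum_comp, ← G.map_sum]
        rw [sum_onb_comp_dag_onb hx]
        simp
      right_inv := fun f => by
        ext q j
        simp only [Preadditive.comp_sum]
        rw [Finset.sum_eq_single q]
        · rw [Finset.sum_eq_single j]
          · rw [← Category.assoc, ← G.map_comp, dag_onb_comp_onb]
            simp
          · intro i _ hi
            rw [← Category.assoc, ← G.map_comp, dag_onb_comp_onb]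
            simp [hi.symm]
          · simp
        · intro p _ hp
          refine Finset.sum_eq_zero fun i _ => ?_
          rw [← Category.assoc, ← G.map_comp, dag_onb_comp_onb_of_ne hx X hp.symm]
          simp
        · simp }
  rw [e.finrank_eq, Module.finrank_pi_fintype]
  refine Finset.sum_congr rfl fun p _ => ?_
  rw [Module.finrank_pi_fintype]
  simp

lemma exists_iso_of_forall_eq_smul_id (hx : IsSimpleList x) {X : D} (hX : 𝟙 X ≠ 0)
    (h : ∀ f : X ⟶ X, ∃ c : ℂ, f = c • 𝟙 X) : ∃ p, Nonempty (X ≅ x p) := by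
  classical
  have := hx.simple
  have hsum := sum_onb_comp_dag_onb hx X
  obtain ⟨p, i, hi⟩ : ∃ p i, onb X (x p) i ≫ dag (onb X (x p) i) ≠ 0 := by
    by_contra! hc
    exact hX (by rw [← hsum]; exact Finset.sum_eq_zero fun p _ =>
      Finset.sum_eq_zero fun i _ => hc p i)
  have hu : dag (onb X (x p) i) ≫ onb X (x p) i = 𝟙 (x p) := by simp [dag_onb_comp_onb]
  obtain ⟨c, hc⟩ := h (onb X (x p) i ≫ dag (onb X (x p) i))
  have hidem : c • onb X (x p) i = onb X (x p) i := by
    have := congrArg (· ≫ onb X (x p) i) hc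
    simpa [hu] using this.symm
  have hc1 : c = 1 := by
    by_contra hne
    have : (c - 1) • onb X (x p) i = 0 := by rw [sub_smul, hidem, one_smul, sub_self]
    rcases smul_eq_zero.1 this with h0 | h0
    · exact hne (sub_eq_zero.1 h0)
    · exact hi (by rw [h0, zero_comp])
  exact ⟨p, ⟨⟨onb X (x p) i, dag (onb X (x p) i), by rw [hc, hc1, one_smul], hu⟩⟩⟩

lemma finrank_hom_dag (X Y : D) : Module.finrank ℂ (X ⟶ Y) = Module.finrank ℂ (Y ⟶ X) := by
  let e : (X ⟶ Y) ≃+ (Y ⟶ X) :=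
    { toFun := dag, invFun := dag, left_inv := dag_dag, right_inv := dag_dag, map_add' := dag_add }
  have := rank_eq_of_equiv_equiv (R := ℂ) (R' := ℂ) conj e (starRingAut (R := ℂ)).bijective
    (fun c f => dag_smul c f)
  exact congrArg Cardinal.toNat this

end UnitaryCategory

section Pairings

open UnitaryCategory DaggerCategory UnitaryFusionCategory

variable {C : Type u} [Category.{v} C] [Abelian C] [Linear ℂ C] [MonoidalCategory C]
  [MonoidalPreadditive C] [MonoidalLinear ℂ C] [RigidCategory C] [UnitaryCategory C]
  [UnitaryFusionCategory C]

attribute [instance] UnitaryFusionCategory.simple_unit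

lemma dag_whiskerLeft (X : C) {Y Z : C} (f : Y ⟶ Z) : dag (X ◁ f) = X ◁ dag f := by
  rw [← id_tensorHom, dag_tensorHom, dag_id, id_tensorHom]

lemma dag_whiskerRight {Y Z : C} (f : Y ⟶ Z) (X : C) : dag (f ▷ X) = dag f ▷ X := by
  rw [← tensorHom_id, dag_tensorHom, dag_id, tensorHom_id]

lemma dag_associator_inv (X Y Z : C) : dag (α_ X Y Z).inv = (α_ X Y Z).hom := by
  rw [← dag_associator, dag_dag]

lemma dag_leftUnitor_inv (X : C) : dag (λ_ X).inv = (λ_ X).hom := by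
  rw [← dag_leftUnitor, dag_dag]

lemma dag_rightUnitor_inv (X : C) : dag (ρ_ X).inv = (ρ_ X).hom := by
  rw [← dag_rightUnitor, dag_dag]

/-- Simplification of `dag` on composites of whiskerings and structural isomorphisms. -/
theorem dag_lemmas : (∀ {X Y Z : C} (f : X ⟶ Y) (g : Y ⟶ Z), dag (f ≫ g) = dag g ≫ dag f) ∧
    (∀ {X Y : C} (f : X ⟶ Y), dag (dag f) = f) ∧
    (∀ (X : C) {Y Z : C} (f : Y ⟶ Z), dag (X ◁ f) = X ◁ dag f) ∧
    (∀ {Y Z : C} (f : Y ⟶ Z) (X : C), dag (f ▷ X) = dag f ▷ X) ∧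
    (∀ X Y Z : C, dag (α_ X Y Z).hom = (α_ X Y Z).inv) ∧
    (∀ X Y Z : C, dag (α_ X Y Z).inv = (α_ X Y Z).hom) ∧
    (∀ X : C, dag (λ_ X).hom = (λ_ X).inv) ∧ (∀ X : C, dag (λ_ X).inv = (λ_ X).hom) ∧
    (∀ X : C, dag (ρ_ X).hom = (ρ_ X).inv) ∧ (∀ X : C, dag (ρ_ X).inv = (ρ_ X).hom) :=
  ⟨dag_comp, dag_dag, dag_whiskerLeft, dag_whiskerRight, dag_associator, dag_associator_inv,
    dag_leftUnitor, dag_leftUnitor_inv, dag_rightUnitor, dag_rightUnitor_inv⟩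

/-- A duality pairing between `X` and `Y` both of whose loops have the value `d`. -/
structure BalancedPairing (X Y : C) (d : ℝ) where
  coev : 𝟙_ C ⟶ X ⊗ Y
  ev : Y ⊗ X ⟶ 𝟙_ C
  zag : Y ◁ coev ≫ (α_ Y X Y).inv ≫ ev ▷ Y = (ρ_ Y).hom ≫ (λ_ Y).inv
  zig : coev ▷ X ≫ (α_ X Y X).hom ≫ X ◁ ev = (λ_ X).hom ≫ (ρ_ X).inv
  coev_loop : coev ≫ dag coev = (d : ℂ) • 𝟙 (𝟙_ C)
  ev_loop : dag ev ≫ ev = (d : ℂ) • 𝟙 (𝟙_ C)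

namespace BalancedPairing

variable {X Y : C} {d : ℝ}

/-- The underlying exact pairing. -/
@[reducible]
def toExactPairing (P : BalancedPairing X Y d) : ExactPairing X Y where
  coevaluation' := P.coev
  evaluation' := P.ev
  coevaluation_evaluation' := P.zag
  evaluation_coevaluation' := P.zig

lemma coev_ev (P : BalancedPairing X Y d) : Y ◁ P.coev ⊗≫ P.ev ▷ Y = ⊗𝟙.hom := by
  convert! P.zag <;> simp [monoidalComp]

lemma ev_coev (P : BalancedPairing X Y d) : P.coev ▷ X ⊗≫ X ◁ P.ev = ⊗𝟙.hom := by
  convert! P.zig <;> simp [monoidalComp]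

/-- The adjoint pairing, which exhibits `X` as a dual of `Y`. -/
def symm (P : BalancedPairing X Y d) : BalancedPairing Y X d where
  coev := dag P.ev
  ev := dag P.coev
  zag := by
    have := congrArg dag P.zig
    simpa only [dag_lemmas, Category.assoc] using this
  zig := by
    have := congrArg dag P.zag
    simpa only [dag_lemmas, Category.assoc] using this
  coev_loop := by rw [dag_dag, P.ev_loop]
  ev_loop := by rw [dag_dag, P.coev_loop]

@[simp] lemma symm_coev (P : BalancedPairing X Y d) : P.symm.coev = dag P.ev := rfl

@[simp] lemma symm_ev (P : BalancedPairing X Y d) : P.symm.ev = dag P.coev := rfl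

end BalancedPairing

lemma CategoryTheory.ExactPairing.coevaluation_ne_zero {X Y : C} [Simple X] (P : ExactPairing X Y) :
    η_ X Y ≠ 0 := by
  intro h
  have := ExactPairing.evaluation_coevaluation X Y
  rw [h] at this
  simp only [MonoidalPreadditive.zero_whiskerRight, zero_comp] at this
  have h2 : 𝟙 X = 0 := by
    have h3 := congrArg (fun f => (λ_ X).inv ≫ f ≫ (ρ_ X).hom) this
    simpa using h3.symm
  exact id_nonzero X h2

lemma CategoryTheory.ExactPairing.evaluation_ne_zero {X Y : C} [Simple X] (P : ExactPairing X Y) :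
    ε_ X Y ≠ 0 := by
  intro h
  have := ExactPairing.evaluation_coevaluation X Y
  rw [h] at this
  simp only [MonoidalPreadditive.whiskerLeft_zero, comp_zero] at this
  have h2 : 𝟙 X = 0 := by
    have h3 := congrArg (fun f => (λ_ X).inv ≫ f ≫ (ρ_ X).hom) this
    simpa using h3.symm
  exact id_nonzero X h2

/-- The dual of a simple object has only scalar endomorphisms. -/
lemma CategoryTheory.ExactPairing.end_dual_eq_smul_id {X Y : C} [Simple X] (P : ExactPairing X Y)
    (f : Y ⟶ Y) : ∃ c : ℂ, f = c • 𝟙 Y := by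
  let L := tensorLeftHomEquiv (𝟙_ C) X Y Y
  let R := tensorRightHomEquiv (𝟙_ C) X Y X
  obtain ⟨c, hc⟩ := endomorphism_simple_eq_smul_id ℂ ((λ_ X).inv ≫ R.symm (L ((ρ_ Y).hom ≫ f)))
  refine ⟨c, ?_⟩
  have h1 : R.symm (L ((ρ_ Y).hom ≫ f)) = c • (λ_ X).hom := by
    rw [Iso.eq_inv_comp] at hc
    simpa using hc.symm
  have h2 : L ((ρ_ Y).hom ≫ f) = R (c • (λ_ X).hom) := by rw [← h1, Equiv.apply_symm_apply]
  have h3 : L ((ρ_ Y).hom ≫ f) = L (c • (ρ_ Y).hom) := by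
    rw [h2]
    have hu : (ρ_ (𝟙_ C)).inv ≫ (λ_ (𝟙_ C)).hom ≫ η_ X Y = η_ X Y := by
      rw [← unitors_inv_equal, Iso.inv_hom_id_assoc]
    have hu' : (λ_ (𝟙_ C)).inv ≫ (ρ_ (𝟙_ C)).hom ≫ η_ X Y = η_ X Y := by
      rw [unitors_inv_equal, Iso.inv_hom_id_assoc]
    simp [L, R, tensorLeftHomEquiv, tensorRightHomEquiv, hu, hu']
  have h4 := L.injective h3
  rw [← cancel_epi (ρ_ Y).hom, h4]
  simp

lemma CategoryTheory.ExactPairing.id_dual_ne_zero {X Y : C} [Simple X] (P : ExactPairing X Y) :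
    𝟙 Y ≠ 0 := by
  intro h
  apply P.coevaluation_ne_zero
  rw [← Category.comp_id (η_ X Y), ← MonoidalCategory.whiskerLeft_id, h]
  simp

variable {ι : Type*} [Fintype ι] {x : ι → C}

lemma CategoryTheory.ExactPairing.simple_dual {X Y : C} [Simple X] (P : ExactPairing X Y) :
    Simple Y := by
  obtain ⟨k, y, hy⟩ := finite_simples (C := C)
  obtain ⟨p, ⟨e⟩⟩ := exists_iso_of_forall_eq_smul_id hy P.id_dual_ne_zero P.end_dual_eq_smul_id
  have := hy.simple p
  exact Simple.of_iso e

namespace BalancedPairing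

variable {X Y : C} {d : ℝ}

lemma simple_dual [Simple X] (P : BalancedPairing X Y d) : Simple Y := P.toExactPairing.simple_dual

lemma pos [Simple X] (P : BalancedPairing X Y d) : 0 < d := by
  have h := schurScalar_comp_dag_nonneg P.coev
  have h0 : schurScalar _ (P.coev ≫ dag P.coev) ≠ 0 := fun h =>
    P.toExactPairing.coevaluation_ne_zero (schurScalar_comp_dag_eq_zero h)
  rw [schurScalar_eq P.coev_loop] at h h0
  have h1 : 0 ≤ d := by exact_mod_cast h
  have h2 : d ≠ 0 := by exact_mod_cast h0
  positivity

lemma dim_unique [Simple X] {Y' : C} {d' : ℝ} (P : BalancedPairing X Y d)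
    (P' : BalancedPairing X Y' d') : d = d' := by
  have hY := P.simple_dual
  have hY' := P'.simple_dual
  let φ : Y ⟶ Y' := (ρ_ Y).inv ≫ Y ◁ P'.coev ≫ (α_ _ _ _).inv ≫ P.ev ▷ Y' ≫ (λ_ Y').hom
  have h1 : P.coev ≫ X ◁ φ = P'.coev := by
    calc P.coev ≫ X ◁ φ = 𝟙 _ ⊗≫ (P.coev ▷ (𝟙_ C) ≫ (X ⊗ Y) ◁ P'.coev) ⊗≫
          X ◁ P.ev ▷ Y' ⊗≫ 𝟙 _ := by dsimp only [φ]; monoidal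
      _ = P'.coev ⊗≫ (P.coev ▷ X ⊗≫ X ◁ P.ev) ▷ Y' ⊗≫ 𝟙 _ := by
        rw [← whisker_exchange]; monoidal
      _ = P'.coev := by rw [P.ev_coev]; monoidal
  have h2 : φ ▷ X ≫ P'.ev = P.ev := by
    calc φ ▷ X ≫ P'.ev = 𝟙 _ ⊗≫ Y ◁ P'.coev ▷ X ⊗≫ (P.ev ▷ (Y' ⊗ X) ≫ (𝟙_ C) ◁ P'.ev)
          ⊗≫ 𝟙 _ := by dsimp only [φ]; monoidal
      _ = 𝟙 _ ⊗≫ Y ◁ (P'.coev ▷ X ⊗≫ X ◁ P'.ev) ⊗≫ P.ev := by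
        rw [← whisker_exchange]; monoidal
      _ = P.ev := by rw [P'.ev_coev]; monoidal
  have h3 : (d' : ℂ) = schurScalar Y (φ ≫ dag φ) * d := by
    have h := P'.coev_loop
    rw [← h1] at h
    simp only [dag_lemmas, Category.assoc] at h
    rw [← MonoidalCategory.whiskerLeft_comp_assoc, ← schurScalar_smul_id (φ ≫ dag φ)] at h
    simp only [MonoidalLinear.whiskerLeft_smul, MonoidalCategory.whiskerLeft_id,
      Linear.comp_smul, Category.id_comp, Linear.smul_comp, P.coev_loop, smul_smul] at h
    exact smul_left_injective ℂ (id_nonzero (𝟙_ C)) h.symm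
  have h4 : (d : ℂ) = schurScalar Y' (dag φ ≫ φ) * d' := by
    have h := P.ev_loop
    rw [← h2] at h
    simp only [dag_lemmas, Category.assoc] at h
    rw [← comp_whiskerRight_assoc, ← schurScalar_smul_id (dag φ ≫ φ)] at h
    simp only [MonoidalLinear.smul_whiskerRight, id_whiskerRight,
      Linear.comp_smul, Category.id_comp, Linear.smul_comp, P'.ev_loop, smul_smul] at h
    exact smul_left_injective ℂ (id_nonzero (𝟙_ C)) h.symm
  have hφ : φ ≠ 0 := by
    intro h
    rw [h] at h2
    simp only [MonoidalPreadditive.zero_whiskerRight, zero_comp] at h2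
    exact P.toExactPairing.evaluation_ne_zero h2.symm
  have h5 : schurScalar Y (φ ≫ dag φ) = schurScalar Y' (dag φ ≫ φ) := by
    refine smul_left_injective ℂ hφ ?_
    have e1 : schurScalar Y (φ ≫ dag φ) • φ = (φ ≫ dag φ) ≫ φ := by
      conv_rhs => rw [← schurScalar_smul_id (φ ≫ dag φ)]
      simp
    have e2 : schurScalar Y' (dag φ ≫ φ) • φ = φ ≫ (dag φ ≫ φ) := by
      conv_rhs => rw [← schurScalar_smul_id (dag φ ≫ φ)]
      simp
    dsimp only
    rw [e1, e2, Category.assoc]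
  have h6 : (d : ℂ) * d = d' * d' := by
    linear_combination (d : ℂ) * h4 - d' * h3 - d * d' * h5
  have h7 : d * d = d' * d' := by exact_mod_cast h6
  have := P.pos
  have := P'.pos
  nlinarith

lemma quantumDim_eq [Simple X] (P : BalancedPairing X Y d) : quantumDim X = d := by
  have : {d : ℝ | ∃ (Y : C) (_ : ExactPairing X Y),
      η_ X Y ≫ dag (η_ X Y) = (d : ℂ) • 𝟙 (𝟙_ C) ∧
      dag (ε_ X Y) ≫ ε_ X Y = (d : ℂ) • 𝟙 (𝟙_ C)} = {d} := by
    ext d'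
    constructor
    · rintro ⟨Y', p, h1, h2⟩
      exact (P.dim_unique ⟨η_ X Y', ε_ X Y', ExactPairing.coevaluation_evaluation X Y',
        ExactPairing.evaluation_coevaluation X Y', h1, h2⟩).symm
    · rintro rfl
      exact ⟨Y, P.toExactPairing, P.coev_loop, P.ev_loop⟩
  rw [quantumDim, this, csInf_singleton]

end BalancedPairing

/-- An exact pairing of a simple object can be rescaled so that its two loops agree. -/
lemma CategoryTheory.ExactPairing.exists_balancedPairing {X Y : C} [Simple X]
    (P : ExactPairing X Y) :
    ∃ d, Nonempty (BalancedPairing X Y d) := by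
  obtain ⟨p, hp0, hp⟩ : ∃ p : ℝ, 0 < p ∧ η_ X Y ≫ dag (η_ X Y) = (p : ℂ) • 𝟙 (𝟙_ C) := by
    have h := schurScalar_comp_dag_nonneg (η_ X Y)
    have h0 : schurScalar _ (η_ X Y ≫ dag (η_ X Y)) ≠ 0 := fun h =>
      P.coevaluation_ne_zero (schurScalar_comp_dag_eq_zero h)
    have hr := Complex.eq_re_of_ofReal_le h
    refine ⟨_, ?_, by rw [← hr, schurScalar_smul_id]⟩
    rw [hr] at h h0
    exact lt_of_le_of_ne (by exact_mod_cast h) (fun h' => h0 (by rw [← h']; simp))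
  obtain ⟨q, hq0, hq⟩ : ∃ q : ℝ, 0 < q ∧ dag (ε_ X Y) ≫ ε_ X Y = (q : ℂ) • 𝟙 (𝟙_ C) := by
    have h := schurScalar_dag_comp_nonneg (ε_ X Y)
    have h0 : schurScalar _ (dag (ε_ X Y) ≫ ε_ X Y) ≠ 0 := fun h =>
      P.evaluation_ne_zero (schurScalar_dag_comp_eq_zero h)
    have hr := Complex.eq_re_of_ofReal_le h
    refine ⟨_, ?_, by rw [← hr, schurScalar_smul_id]⟩
    rw [hr] at h h0
    exact lt_of_le_of_ne (by exact_mod_cast h) (fun h' => h0 (by rw [← h']; simp))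
  let r : ℝ := √(√(q / p))
  have hr : 0 < r := by positivity
  have hr4 : r * r * (r * r) = q / p := by
    rw [Real.mul_self_sqrt (Real.sqrt_nonneg _), Real.mul_self_sqrt (by positivity)]
  have hrC : (r : ℂ) ≠ 0 := by exact_mod_cast hr.ne'
  refine ⟨r * r * p, ⟨⟨(r : ℂ) • η_ X Y, (r : ℂ)⁻¹ • ε_ X Y, ?_, ?_, ?_, ?_⟩⟩⟩
  · simp only [MonoidalLinear.whiskerLeft_smul, MonoidalLinear.smul_whiskerRight,
      Linear.comp_smul, Linear.smul_comp, smul_smul, inv_mul_cancel₀ hrC, one_smul,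
      ExactPairing.coevaluation_evaluation]
  · simp only [MonoidalLinear.whiskerLeft_smul, MonoidalLinear.smul_whiskerRight,
      Linear.comp_smul, Linear.smul_comp, smul_smul, inv_mul_cancel₀ hrC, one_smul,
      ExactPairing.evaluation_coevaluation]
  · simp only [dag_smul, Linear.comp_smul, Linear.smul_comp, hp, smul_smul, Complex.conj_ofReal]
    push_cast
    rw [mul_assoc]
  · simp only [dag_smul, Linear.comp_smul, Linear.smul_comp, hq, smul_smul, map_inv₀,
      Complex.conj_ofReal]
    congr 1
    norm_cast
    have : q = r * r * (r * r) * p := by rw [hr4]; field_simp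
    rw [this]
    field_simp

lemma exists_dual_index (hx : IsSimpleList x) (i : ι) :
    ∃ i', Nonempty (BalancedPairing (x i) (x i') (quantumDim (x i))) := by
  have := hx.simple i
  let P : ExactPairing (x i) ((x i)ᘁ) := inferInstance
  obtain ⟨j, ⟨e⟩⟩ := hx.complete _ P.simple_dual
  let Q : ExactPairing (x i) (x j) := exactPairingCongrRight e.symm
  obtain ⟨d, ⟨B⟩⟩ := Q.exists_balancedPairing
  exact ⟨j, by rw [B.quantumDim_eq]; exact ⟨B⟩⟩

/-- The index of the dual of the simple object `x i`. -/
noncomputable def dualIdx (hx : IsSimpleList x) (i : ι) : ι := (exists_dual_index hx i).choose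

/-- A balanced pairing of `x i` with its dual. -/
noncomputable def dualPairing (hx : IsSimpleList x) (i : ι) :
    BalancedPairing (x i) (x (dualIdx hx i)) (quantumDim (x i)) :=
  (exists_dual_index hx i).choose_spec.some

lemma quantumDim_pos (hx : IsSimpleList x) (i : ι) : 0 < quantumDim (x i) :=
  have := hx.simple i
  (dualPairing hx i).pos

lemma quantumDim_dualIdx (hx : IsSimpleList x) (i : ι) :
    quantumDim (x (dualIdx hx i)) = quantumDim (x i) :=
  have := hx.simple (dualIdx hx i)
  (dualPairing hx i).symm.quantumDim_eq

lemma dualIdx_involutive (hx : IsSimpleList x) : Function.Involutive (dualIdx hx) := fun i =>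
  hx.irredundant _ _ ⟨rightDualIso (dualPairing hx (dualIdx hx i)).toExactPairing
    (dualPairing hx i).symm.toExactPairing⟩

end Pairings

section PartialTrace

open UnitaryCategory DaggerCategory UnitaryFusionCategory

lemma schurScalar_comp_le {D : Type u} [Category.{v} D] [Abelian D] [Linear ℂ D]
    [UnitaryCategory D] {k W : D} [Simple k] (p : k ⟶ W) (q : W ⟶ k) :
    ‖schurScalar k (p ≫ q)‖ ^ 2 ≤
      (schurScalar k (p ≫ dag p)).re * (schurScalar k (dag q ≫ q)).re := by
  let c := homInnerCore W k
  have hin : ∀ f g : W ⟶ k, c.inner f g = schurScalar k (dag f ≫ g) := fun _ _ => rfl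
  have := InnerProductSpace.Core.inner_mul_inner_self_le (𝕜 := ℂ) (F := W ⟶ k) (dag p) q
  have e : ‖schurScalar k (dag q ≫ dag p)‖ = ‖schurScalar k (p ≫ q)‖ := by
    rw [← dag_comp, schurScalar_dag, RCLike.norm_conj]
  simp only [hin, dag_dag, e] at this
  rw [sq]
  exact this

variable {C : Type u} [Category.{v} C] [Abelian C] [Linear ℂ C] [MonoidalCategory C]
  [MonoidalPreadditive C] [MonoidalLinear ℂ C] [RigidCategory C] [UnitaryCategory C]
  [UnitaryFusionCategory C]

namespace BalancedPairing

variable {X Y : C} {d : ℝ}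

/-- The coevaluation inserted to the right of an object. -/
def ins (P : BalancedPairing X Y d) (A : C) : A ⟶ (A ⊗ X) ⊗ Y :=
  (ρ_ A).inv ≫ A ◁ P.coev ≫ (α_ A X Y).inv

lemma dag_ins (P : BalancedPairing X Y d) (A : C) :
    dag (P.ins A) = (α_ A X Y).hom ≫ A ◁ dag P.coev ≫ (ρ_ A).hom := by
  simp only [ins, dag_lemmas, Category.assoc]

lemma ins_naturality (P : BalancedPairing X Y d) {A B : C} (f : A ⟶ B) :
    f ≫ P.ins B = P.ins A ≫ f ▷ X ▷ Y := by
  simp only [ins]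
  calc _ = 𝟙 _ ⊗≫ (f ▷ (𝟙_ C) ≫ B ◁ P.coev) ⊗≫ 𝟙 _ := by monoidal
    _ = _ := by rw [← whisker_exchange]; monoidal

lemma dag_ins_naturality (P : BalancedPairing X Y d) {A B : C} (f : A ⟶ B) :
    f ▷ X ▷ Y ≫ dag (P.ins B) = dag (P.ins A) ≫ f := by
  have := congrArg dag (P.ins_naturality (dag f))
  simpa only [dag_lemmas] using this.symm

/-- The right partial trace. -/
def ptr (P : BalancedPairing X Y d) {A B : C} (f : A ⊗ X ⟶ B ⊗ X) : A ⟶ B :=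
  P.ins A ≫ f ▷ Y ≫ dag (P.ins B)

lemma ptr_id (P : BalancedPairing X Y d) (A : C) : P.ptr (𝟙 (A ⊗ X)) = (d : ℂ) • 𝟙 A := by
  simp only [ptr, id_whiskerRight, Category.id_comp, dag_ins]
  simp only [ins, Category.assoc, Iso.inv_hom_id_assoc]
  rw [← MonoidalCategory.whiskerLeft_comp_assoc, P.coev_loop]
  simp only [MonoidalLinear.whiskerLeft_smul, MonoidalCategory.whiskerLeft_id, Category.id_comp,
    Linear.smul_comp, Linear.comp_smul, Iso.inv_hom_id]

lemma ptr_sum (P : BalancedPairing X Y d) {A B : C} {I : Type*} (s : Finset I)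
    (f : I → (A ⊗ X ⟶ B ⊗ X)) : P.ptr (∑ i ∈ s, f i) = ∑ i ∈ s, P.ptr (f i) := by
  simp only [ptr, sum_whiskerRight, Preadditive.comp_sum, Preadditive.sum_comp]

lemma ptr_smul (P : BalancedPairing X Y d) {A B : C} (c : ℂ) (f : A ⊗ X ⟶ B ⊗ X) :
    P.ptr (c • f) = c • P.ptr f := by
  simp only [ptr, MonoidalLinear.smul_whiskerRight, Linear.comp_smul, Linear.smul_comp]

/-- Bending the right leg of `y : A ⊗ X ⟶ B` upwards. -/
def bend (P : BalancedPairing X Y d) {A B : C} (y : A ⊗ X ⟶ B) : A ⟶ B ⊗ Y :=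
  P.ins A ≫ y ▷ Y

lemma bend_comp_dag_bend (P : BalancedPairing X Y d) {A B : C} (y : A ⊗ X ⟶ B) :
    P.bend y ≫ dag (P.bend y) = P.ptr (y ≫ dag y) := by
  simp only [bend, ptr, dag_lemmas, comp_whiskerRight, Category.assoc]

lemma bend_symm (P : BalancedPairing X Y d) {A B : C} (y : A ⊗ X ⟶ B) :
    P.bend y ▷ X ≫ dag (P.symm.ins B) = y := by
  simp only [bend, dag_ins, symm_coev, dag_dag]
  simp only [ins]
  calc _ = 𝟙 _ ⊗≫ A ◁ P.coev ▷ X ⊗≫ (y ▷ (Y ⊗ X) ≫ B ◁ P.ev) ⊗≫ 𝟙 _ := by monoidal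
    _ = 𝟙 _ ⊗≫ A ◁ (P.coev ▷ X ⊗≫ X ◁ P.ev) ⊗≫ y := by
      rw [← whisker_exchange]; monoidal
    _ = y := by rw [P.ev_coev]; monoidal

lemma symm_ptr_bend (P : BalancedPairing X Y d) {A B : C} (y : A ⊗ X ⟶ B) :
    P.symm.ptr (dag (P.bend y) ≫ P.bend y) = dag y ≫ y := by
  conv_rhs => rw [← P.bend_symm y]
  simp only [ptr, dag_lemmas, comp_whiskerRight, Category.assoc]

end BalancedPairing

variable {j j' b b' a a' : C} {dj db da : ℝ} [Simple j] [Simple b] [Simple a]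

/-- The value of a theta graph does not depend on which of two edges is cut. -/
lemma ptr_schurScalar_mul (Pj : BalancedPairing j j' dj) (Pb : BalancedPairing b b' db)
    (g : j ⊗ b ⟶ j ⊗ b) :
    schurScalar j (Pb.ptr g) * dj =
      schurScalar b ((λ_ b).inv ≫ dag Pj.ev ▷ b ≫ (α_ _ _ _).hom ≫ j' ◁ g ≫ (α_ _ _ _).inv ≫
        Pj.ev ▷ b ≫ (λ_ b).hom) * db := by
  set h := (λ_ b).inv ≫ dag Pj.ev ▷ b ≫ (α_ _ _ _).hom ≫ j' ◁ g ≫ (α_ _ _ _).inv ≫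
        Pj.ev ▷ b ≫ (λ_ b).hom with hh
  have e1 : dag Pj.ev ≫ j' ◁ Pb.ptr g ≫ Pj.ev =
      (schurScalar j (Pb.ptr g) * dj) • 𝟙 (𝟙_ C) := by
    conv_lhs => rw [← schurScalar_smul_id (Pb.ptr g)]
    simp only [MonoidalLinear.whiskerLeft_smul, MonoidalCategory.whiskerLeft_id,
      Linear.smul_comp, Linear.comp_smul, Category.id_comp, Pj.ev_loop, smul_smul]
  have e2 : Pb.coev ≫ h ▷ b' ≫ dag Pb.coev = (schurScalar b h * db) • 𝟙 (𝟙_ C) := by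
    conv_lhs => rw [← schurScalar_smul_id h]
    simp only [MonoidalLinear.smul_whiskerRight, id_whiskerRight,
      Linear.smul_comp, Linear.comp_smul, Category.id_comp, Pb.coev_loop, smul_smul]
  refine smul_left_injective ℂ (id_nonzero (𝟙_ C)) ?_
  dsimp only
  rw [← e1, ← e2, hh]
  simp only [BalancedPairing.ptr, BalancedPairing.dag_ins]
  simp only [BalancedPairing.ins]
  calc _ = 𝟙 _ ⊗≫ (dag Pj.ev ▷ (𝟙_ C) ≫ (j' ⊗ j) ◁ Pb.coev) ⊗≫ j' ◁ g ▷ b' ⊗≫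
        ((j' ⊗ j) ◁ dag Pb.coev ≫ Pj.ev ▷ (𝟙_ C)) ⊗≫ 𝟙 _ := by monoidal
    _ = _ := by
      rw [whisker_exchange Pj.ev (dag Pb.coev), ← whisker_exchange (dag Pj.ev) Pb.coev]; monoidal

lemma theta_le (Pj : BalancedPairing j j' dj) (Pb : BalancedPairing b b' db)
    (Pa : BalancedPairing a a' da) (y : j ⊗ b ⟶ a) :
    (schurScalar a (dag y ≫ y)).re * da ≤ (schurScalar j (Pb.ptr (y ≫ dag y))).re * dj := by
  have := Pa.simple_dual
  have hda := Pa.pos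
  have hdj := Pj.pos
  set y2 := Pb.bend y with hy2
  have he := Pb.bend_comp_dag_bend y
  rw [← hy2] at he
  set y3 : b ⟶ j' ⊗ a := (λ_ b).inv ≫ dag Pj.ev ▷ b ≫ (α_ _ _ _).hom ≫ j' ◁ y with hy3
  have hf := ptr_schurScalar_mul Pj Pb (y ≫ dag y)
  have hf3 : y3 ≫ dag y3 = (λ_ b).inv ≫ dag Pj.ev ▷ b ≫ (α_ _ _ _).hom ≫ j' ◁ (y ≫ dag y) ≫
      (α_ _ _ _).inv ≫ Pj.ev ▷ b ≫ (λ_ b).hom := by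
    simp only [hy3, dag_lemmas, Category.assoc, MonoidalCategory.whiskerLeft_comp]
  rw [← hf3, ← he] at hf
  set c := schurScalar a (dag y ≫ y) with hc
  set e := schurScalar j (y2 ≫ dag y2)
  set f := schurScalar b (y3 ≫ dag y3)
  set P0 : 𝟙_ C ⟶ a ⊗ (b' ⊗ j') := Pj.coev ≫ y2 ▷ j' ≫ (α_ _ _ _).hom with hP0
  set Q0 : (b' ⊗ j') ⊗ a ⟶ 𝟙_ C := (α_ _ _ _).hom ≫ b' ◁ dag y3 ≫ Pb.ev with hQ0
  set p : a' ⟶ b' ⊗ j' := (ρ_ a').inv ≫ a' ◁ P0 ≫ (α_ _ _ _).inv ≫ Pa.ev ▷ _ ≫ (λ_ _).hom with hp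
  set q : b' ⊗ j' ⟶ a' := (ρ_ _).inv ≫ _ ◁ Pa.coev ≫ (α_ _ _ _).inv ≫ Q0 ▷ _ ≫ (λ_ _).hom with hq
  have hpP : Pa.coev ≫ a ◁ p = P0 := by
    calc _ = 𝟙 _ ⊗≫ (Pa.coev ▷ (𝟙_ C) ≫ (a ⊗ a') ◁ P0) ⊗≫ a ◁ Pa.ev ▷ (b' ⊗ j') ⊗≫ 𝟙 _ := by
          rw [hp]; monoidal
      _ = P0 ⊗≫ (Pa.coev ▷ a ⊗≫ a ◁ Pa.ev) ▷ (b' ⊗ j') ⊗≫ 𝟙 _ := by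
          rw [← whisker_exchange]; monoidal
      _ = P0 := by rw [Pa.ev_coev]; monoidal
  have hqQ : q ▷ a ≫ Pa.ev = Q0 := by
    calc _ = 𝟙 _ ⊗≫ (b' ⊗ j') ◁ Pa.coev ▷ a ⊗≫ (Q0 ▷ (a' ⊗ a) ≫ (𝟙_ C) ◁ Pa.ev) ⊗≫ 𝟙 _ := by
          rw [hq]; monoidal
      _ = 𝟙 _ ⊗≫ (b' ⊗ j') ◁ (Pa.coev ▷ a ⊗≫ a ◁ Pa.ev) ⊗≫ Q0 := by
          rw [← whisker_exchange]; monoidal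
      _ = Q0 := by rw [Pa.ev_coev]; monoidal
  have hpp : schurScalar a' (p ≫ dag p) * da = e * dj := by
    refine smul_left_injective ℂ (id_nonzero (𝟙_ C)) ?_
    have e1 : P0 ≫ dag P0 = (schurScalar a' (p ≫ dag p) * da) • 𝟙 (𝟙_ C) := by
      rw [← hpP]
      simp only [dag_lemmas, Category.assoc]
      conv_lhs => rw [← MonoidalCategory.whiskerLeft_comp_assoc, ← schurScalar_smul_id (p ≫ dag p)]
      simp only [MonoidalLinear.whiskerLeft_smul, MonoidalCategory.whiskerLeft_id,
        Category.id_comp, Linear.smul_comp,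
        Linear.comp_smul, Pa.coev_loop, smul_smul]
    have e2 : P0 ≫ dag P0 = (e * dj) • 𝟙 (𝟙_ C) := by
      simp only [hP0, dag_lemmas, Category.assoc, Iso.hom_inv_id_assoc]
      rw [← comp_whiskerRight_assoc, ← schurScalar_smul_id (y2 ≫ dag y2)]
      simp only [MonoidalLinear.smul_whiskerRight, id_whiskerRight, Category.id_comp,
        Linear.smul_comp,
        Linear.comp_smul, Pj.coev_loop, smul_smul, e]
    exact e1.symm.trans e2
  have hqq : schurScalar a' (dag q ≫ q) * da = f * db := by
    refine smul_left_injective ℂ (id_nonzero (𝟙_ C)) ?_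
    have e1 : dag Q0 ≫ Q0 = (schurScalar a' (dag q ≫ q) * da) • 𝟙 (𝟙_ C) := by
      rw [← hqQ]
      simp only [dag_lemmas, Category.assoc]
      conv_lhs => rw [← comp_whiskerRight_assoc, ← schurScalar_smul_id (dag q ≫ q)]
      simp only [MonoidalLinear.smul_whiskerRight, id_whiskerRight, Category.id_comp,
        Linear.smul_comp,
        Linear.comp_smul, Pa.ev_loop, smul_smul]
    have e2 : dag Q0 ≫ Q0 = (f * db) • 𝟙 (𝟙_ C) := by
      simp only [hQ0, dag_lemmas, Category.assoc, Iso.inv_hom_id_assoc]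
      rw [← MonoidalCategory.whiskerLeft_comp_assoc, ← schurScalar_smul_id (y3 ≫ dag y3)]
      simp only [MonoidalLinear.whiskerLeft_smul, MonoidalCategory.whiskerLeft_id,
        Category.id_comp, Linear.smul_comp,
        Linear.comp_smul, Pb.ev_loop, smul_smul, f]
    exact e1.symm.trans e2
  have hcyc : (λ_ a).inv ≫ P0 ▷ a ≫ (α_ _ _ _).hom ≫ a ◁ Q0 ≫ (ρ_ a).hom = dag y ≫ y := by
    set K : 𝟙_ C ⟶ (j ⊗ b) ⊗ (b' ⊗ j') := Pj.coev ≫ Pb.ins j ▷ j' ≫ (α_ _ _ _).hom with hK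
    have hPK : P0 = K ≫ y ▷ (b' ⊗ j') := by
      rw [hP0, hK, hy2, BalancedPairing.bend]; monoidal
    set V : (b' ⊗ j') ⊗ (j ⊗ b) ⟶ 𝟙_ C :=
      (α_ _ _ _).hom ≫ b' ◁ ((α_ _ _ _).inv ≫ Pj.ev ▷ b ≫ (λ_ b).hom) ≫ Pb.ev with hV
    have hQV : Q0 = (b' ⊗ j') ◁ dag y ≫ V := by
      simp only [hQ0, hV, hy3, dag_lemmas]; monoidal
    have snake : K ▷ (j ⊗ b) ⊗≫ (j ⊗ b) ◁ V = ⊗𝟙.hom := by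
      calc _ = Pj.coev ▷ (j ⊗ b) ⊗≫ j ◁ (Pb.coev ▷ (j' ⊗ j) ≫ (b ⊗ b') ◁ Pj.ev) ▷ b ⊗≫
            (j ⊗ b) ◁ Pb.ev := by rw [hK, hV, BalancedPairing.ins]; monoidal
        _ = 𝟙 (𝟙_ C ⊗ (j ⊗ b)) ⊗≫ (Pj.coev ▷ j ⊗≫ j ◁ Pj.ev) ▷ b ⊗≫
            j ◁ (Pb.coev ▷ b ⊗≫ b ◁ Pb.ev) ⊗≫ 𝟙 ((j ⊗ b) ⊗ 𝟙_ C) := by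
          rw [← whisker_exchange]; monoidal
        _ = _ := by rw [Pj.ev_coev, Pb.ev_coev]; monoidal
    calc _ = 𝟙 _ ⊗≫ K ▷ a ⊗≫ (y ▷ ((b' ⊗ j') ⊗ a) ≫ a ◁ Q0) ⊗≫ 𝟙 _ := by rw [hPK]; monoidal
      _ = 𝟙 _ ⊗≫ (K ▷ a ≫ ((j ⊗ b) ⊗ (b' ⊗ j')) ◁ dag y) ⊗≫ (j ⊗ b) ◁ V ⊗≫ y := by
        rw [← whisker_exchange, hQV]; monoidal
      _ = dag y ⊗≫ (K ▷ (j ⊗ b) ⊗≫ (j ⊗ b) ◁ V) ⊗≫ y := by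
        rw [← whisker_exchange]; monoidal
      _ = _ := by rw [snake]; monoidal
  have hpq : schurScalar a' (p ≫ q) = c := by
    apply schurScalar_eq
    calc p ≫ q = 𝟙 _ ⊗≫ a' ◁ P0 ⊗≫ (Pa.ev ▷ ((b' ⊗ j') ⊗ 𝟙_ C) ≫
            (𝟙_ C) ◁ (b' ⊗ j') ◁ Pa.coev) ⊗≫ Q0 ▷ a' ⊗≫ 𝟙 _ := by
          rw [hp, hq]; monoidal
      _ = 𝟙 _ ⊗≫ a' ◁ (P0 ▷ (𝟙_ C) ≫ (a ⊗ b' ⊗ j') ◁ Pa.coev) ⊗≫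
            (Pa.ev ▷ (((b' ⊗ j') ⊗ a) ⊗ a') ≫ (𝟙_ C) ◁ Q0 ▷ a') ⊗≫ 𝟙 _ := by
          rw [← whisker_exchange]; monoidal
      _ = 𝟙 _ ⊗≫ a' ◁ Pa.coev ⊗≫ a' ◁ ((λ_ a).inv ≫ P0 ▷ a ≫ (α_ _ _ _).hom ≫ a ◁ Q0 ≫
            (ρ_ a).hom) ▷ a' ⊗≫ Pa.ev ▷ a' ⊗≫ 𝟙 _ := by
          rw [← whisker_exchange, ← whisker_exchange]; monoidal
      _ = c • (𝟙 _ ⊗≫ a' ◁ Pa.coev ⊗≫ a' ◁ (𝟙 a) ▷ a' ⊗≫ Pa.ev ▷ a' ⊗≫ 𝟙 _) := by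
          rw [hcyc, ← schurScalar_smul_id (dag y ≫ y), ← hc]
          simp only [monoidalComp, MonoidalLinear.smul_whiskerRight,
            MonoidalLinear.whiskerLeft_smul, Linear.smul_comp, Linear.comp_smul]
      _ = c • (𝟙 _ ⊗≫ (a' ◁ Pa.coev ⊗≫ Pa.ev ▷ a') ⊗≫ 𝟙 _) := by
          congr 1; monoidal
      _ = c • 𝟙 _ := by rw [Pa.coev_ev]; congr 1; monoidal
  have hcs := schurScalar_comp_le p q
  rw [hpq] at hcs
  have hc0 : 0 ≤ c.re := (Complex.le_def.1 (schurScalar_dag_comp_nonneg y)).1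
  have he0 : 0 ≤ e.re := (Complex.le_def.1 (schurScalar_comp_dag_nonneg y2)).1
  have hpr : (schurScalar a' (p ≫ dag p)).re * da = e.re * dj := by
    simpa using congrArg Complex.re hpp
  have hqr : (schurScalar a' (dag q ≫ q)).re * da = e.re * dj := by
    simpa using congrArg Complex.re (hqq.trans hf.symm)
  have hn : c.re ≤ ‖c‖ := Complex.re_le_norm c
  rw [← he]
  have : (c.re * da) ^ 2 ≤ (e.re * dj) ^ 2 := by
    calc (c.re * da) ^ 2 ≤ ‖c‖ ^ 2 * da ^ 2 := by
          rw [mul_pow]; gcongr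
      _ ≤ (schurScalar a' (p ≫ dag p)).re * (schurScalar a' (dag q ≫ q)).re * da ^ 2 := by
          gcongr
      _ = ((schurScalar a' (p ≫ dag p)).re * da) * ((schurScalar a' (dag q ≫ q)).re * da) := by
          ring
      _ = (e.re * dj) ^ 2 := by rw [hpr, hqr, sq]
  exact le_of_sq_le_sq this (by positivity)

/-- The two ways to close a trivalent vertex with its adjoint to a theta graph agree. -/
lemma theta_eq (Pj : BalancedPairing j j' dj) (Pb : BalancedPairing b b' db)
    (Pa : BalancedPairing a a' da) (y : j ⊗ b ⟶ a) :
    schurScalar j (Pb.ptr (y ≫ dag y)) * dj = schurScalar a (dag y ≫ y) * da := by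
  have := Pb.simple_dual
  have h1 := theta_le Pj Pb Pa y
  have h2 := theta_le Pa Pb.symm Pj (dag (Pb.bend y))
  rw [dag_dag, Pb.symm_ptr_bend, Pb.bend_comp_dag_bend] at h2
  have hre : ∀ {z : ℂ}, 0 ≤ z → z = (z.re : ℂ) := fun h => Complex.eq_re_of_ofReal_le h
  have n1 := hre (schurScalar_dag_comp_nonneg y)
  have n2 := schurScalar_comp_dag_nonneg (Pb.bend y)
  rw [Pb.bend_comp_dag_bend] at n2
  rw [n1, hre n2]
  exact_mod_cast le_antisymm h2 h1

end PartialTrace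

section NaturalActions

open UnitaryCategory DaggerCategory UnitaryFusionCategory

variable {C : Type u} [Category.{v} C] [Abelian C] [Linear ℂ C] [MonoidalCategory C]
  [MonoidalPreadditive C] [MonoidalLinear ℂ C] [RigidCategory C] [UnitaryCategory C]
  [UnitaryFusionCategory C]

/-- A family of morphisms `Z ⊗ A ⟶ A` is natural in `A`. -/
def IsNaturalAction (Z : C) (ξ : ∀ A : C, Z ⊗ A ⟶ A) : Prop :=
  ∀ (A B : C) (f : A ⟶ B), Z ◁ f ≫ ξ B = ξ A ≫ f

/-- The orthogonal projection onto the part of `Q` that is a multiple of the unit object. -/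
noncomputable def unitProj (Q : C) : Q ⟶ Q := ∑ i, onb Q (𝟙_ C) i ≫ dag (onb Q (𝟙_ C) i)

namespace BalancedPairing

variable {X Y : C} {d : ℝ}

/-- The action of `X ⊗ Y` on `X` by evaluation. -/
def act (P : BalancedPairing X Y d) : (X ⊗ Y) ⊗ X ⟶ X := (α_ X Y X).hom ≫ X ◁ P.ev ≫ (ρ_ X).hom

lemma dag_act (P : BalancedPairing X Y d) :
    dag P.act = (ρ_ X).inv ≫ X ◁ dag P.ev ≫ (α_ X Y X).inv := by
  simp only [act, dag_lemmas, Category.assoc]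

/-- The action of `X ⊗ Y` on the `X`-isotypic part of an object. -/
noncomputable def isotypicAct [Simple X] (P : BalancedPairing X Y d) (A : C) : (X ⊗ Y) ⊗ A ⟶ A :=
  ∑ i, (X ⊗ Y) ◁ onb A X i ≫ P.act ≫ dag (onb A X i)

lemma whiskerLeft_comp_act [Simple X] (P : BalancedPairing X Y d) (g : X ⟶ X) :
    (X ⊗ Y) ◁ g ≫ P.act = P.act ≫ g := by
  rw [← schurScalar_smul_id g]
  simp

lemma isotypicAct_natural [Simple X] (P : BalancedPairing X Y d) :
    IsNaturalAction (X ⊗ Y) P.isotypicAct := by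
  intro A B f
  have h1 : (X ⊗ Y) ◁ f ≫ P.isotypicAct B = ∑ i, ∑ l, (X ⊗ Y) ◁ onb A X l ≫ P.act ≫
      (dag (onb A X l) ≫ f ≫ onb B X i) ≫ dag (onb B X i) := by
    rw [isotypicAct, Preadditive.comp_sum]
    refine Finset.sum_congr rfl fun i _ => ?_
    rw [← MonoidalCategory.whiskerLeft_comp_assoc]
    conv_lhs => rw [← sum_onb_comp (f ≫ onb B X i)]
    rw [whiskerLeft_sum, Preadditive.sum_comp]
    refine Finset.sum_congr rfl fun l _ => ?_
    rw [MonoidalCategory.whiskerLeft_comp_assoc, ← Category.assoc _ P.act, P.whiskerLeft_comp_act]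
    simp only [Category.assoc]
  have h2 : P.isotypicAct A ≫ f = ∑ l, ∑ i, (X ⊗ Y) ◁ onb A X l ≫ P.act ≫
      (dag (onb A X l) ≫ f ≫ onb B X i) ≫ dag (onb B X i) := by
    rw [isotypicAct, Preadditive.sum_comp]
    refine Finset.sum_congr rfl fun l _ => ?_
    simp only [Category.assoc]
    conv_lhs => rw [← sum_comp_onb (dag (onb A X l) ≫ f)]
    simp only [Preadditive.comp_sum, Category.assoc]
  rw [h1, h2, Finset.sum_comm]

/-- The right partial trace of a natural action. -/
def natPtr (P : BalancedPairing X Y d) {Z : C} (ξ : ∀ A : C, Z ⊗ A ⟶ A) (A : C) : Z ⊗ A ⟶ A :=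
  P.ptr ((α_ Z A X).hom ≫ ξ (A ⊗ X))

lemma comp_ptr (P : BalancedPairing X Y d) {A A' B : C} (g : A' ⟶ A) (f : A ⊗ X ⟶ B ⊗ X) :
    g ≫ P.ptr f = P.ptr (g ▷ X ≫ f) := by
  simp only [ptr, comp_whiskerRight, Category.assoc, reassoc_of% P.ins_naturality g]

lemma ptr_comp (P : BalancedPairing X Y d) {A B B' : C} (f : A ⊗ X ⟶ B ⊗ X) (g : B ⟶ B') :
    P.ptr f ≫ g = P.ptr (f ≫ g ▷ X) := by
  simp only [ptr, comp_whiskerRight, Category.assoc, P.dag_ins_naturality]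

lemma natPtr_natural (P : BalancedPairing X Y d) {Z : C} {ξ : ∀ A : C, Z ⊗ A ⟶ A}
    (h : IsNaturalAction Z ξ) : IsNaturalAction Z (P.natPtr ξ) := by
  intro A B f
  rw [natPtr, natPtr, comp_ptr, ptr_comp, Category.assoc, ← h _ _ (f ▷ X)]
  simp

lemma ptr_whiskerLeft (P : BalancedPairing X Y d) (W : C) {A : C} (f : A ⊗ X ⟶ A ⊗ X) :
    P.ptr ((α_ W A X).hom ≫ W ◁ f ≫ (α_ W A X).inv) = W ◁ P.ptr f := by
  simp only [ptr, dag_ins]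
  simp only [ins]
  monoidal

lemma act_coact_comp [Simple X] (P : BalancedPairing X Y d) {Q : C} (v : X ⊗ Q ⟶ X) :
    dag P.act ▷ Q ≫ (α_ (X ⊗ Y) X Q).hom ≫ (X ⊗ Y) ◁ v ≫ P.act =
      (d : ℂ) • ∑ i, X ◁ onb Q (𝟙_ C) i ≫ X ◁ dag (onb Q (𝟙_ C) i) ≫ v := by
  set w : Q ⟶ 𝟙_ C := (λ_ Q).inv ≫ dag P.ev ▷ Q ≫ (α_ _ _ _).hom ≫ Y ◁ v ≫ P.ev with hw
  have h1 : dag P.act ▷ Q ≫ (α_ (X ⊗ Y) X Q).hom ≫ (X ⊗ Y) ◁ v ≫ P.act = X ◁ w ≫ (ρ_ X).hom := by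
    rw [dag_act, act, hw]
    monoidal
  have h2 : ∀ t : 𝟙_ C ⟶ Q, t ≫ w =
      (schurScalar X ((ρ_ X).inv ≫ X ◁ t ≫ v) * d) • 𝟙 (𝟙_ C) := by
    intro t
    calc t ≫ w = 𝟙 _ ⊗≫ ((𝟙_ C) ◁ t ≫ dag P.ev ▷ Q) ⊗≫ Y ◁ v ≫ P.ev := by
          rw [hw]; monoidal
      _ = dag P.ev ≫ Y ◁ ((ρ_ X).inv ≫ X ◁ t ≫ v) ≫ P.ev := by
          rw [whisker_exchange]; monoidal
      _ = _ := by
          conv_lhs => rw [← schurScalar_smul_id ((ρ_ X).inv ≫ X ◁ t ≫ v)]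
          simp only [MonoidalLinear.whiskerLeft_smul, MonoidalCategory.whiskerLeft_id,
            Category.id_comp, Linear.smul_comp, Linear.comp_smul, P.ev_loop, smul_smul]
  rw [h1, ← sum_onb_comp w, whiskerLeft_sum, Preadditive.sum_comp, Finset.smul_sum]
  refine Finset.sum_congr rfl fun i _ => ?_
  rw [h2]
  have h3 : X ◁ dag (onb Q (𝟙_ C) i) ≫ v =
      schurScalar X ((ρ_ X).inv ≫ X ◁ dag (onb Q (𝟙_ C) i) ≫ v) • (ρ_ X).hom := by
    have := schurScalar_smul_id ((ρ_ X).inv ≫ X ◁ dag (onb Q (𝟙_ C) i) ≫ v)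
    rw [Iso.eq_inv_comp] at this
    refine this.symm.trans ?_
    rw [Linear.comp_smul, Category.comp_id]
  generalize schurScalar X ((ρ_ X).inv ≫ X ◁ dag (onb Q (𝟙_ C) i) ≫ v) = z at h3 ⊢
  rw [h3]
  simp only [Linear.comp_smul, Linear.smul_comp, MonoidalLinear.whiskerLeft_smul, smul_smul,
    Category.comp_id]
  rw [mul_comm]

lemma coact_isotypicAct [Simple X] (P : BalancedPairing X Y d) (Q : C) :
    dag P.act ▷ Q ≫ (α_ (X ⊗ Y) X Q).hom ≫ P.isotypicAct (X ⊗ Q) = (d : ℂ) • X ◁ unitProj Q := by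
  have : dag P.act ▷ Q ≫ (α_ (X ⊗ Y) X Q).hom ≫ P.isotypicAct (X ⊗ Q) =
      ∑ i, (dag P.act ▷ Q ≫ (α_ (X ⊗ Y) X Q).hom ≫ (X ⊗ Y) ◁ onb (X ⊗ Q) X i ≫ P.act) ≫
        dag (onb (X ⊗ Q) X i) := by
    simp only [isotypicAct, Preadditive.comp_sum, Category.assoc]
  rw [this]
  simp only [act_coact_comp, Linear.smul_comp, Preadditive.sum_comp, Category.assoc]
  rw [← Finset.smul_sum, Finset.sum_comm, unitProj, whiskerLeft_sum]
  congr 1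
  refine Finset.sum_congr rfl fun l _ => ?_
  rw [← Preadditive.comp_sum, MonoidalCategory.whiskerLeft_comp]
  congr 1
  have := sum_comp_onb ((ρ_ X).inv ≫ X ◁ dag (onb Q (𝟙_ C) l))
  simp only [Category.assoc] at this
  rw [← Preadditive.comp_sum, cancel_epi] at this
  exact this

lemma coact_natPtr [Simple X] (P : BalancedPairing X Y d) {b b' : C} {db : ℝ}
    (Pb : BalancedPairing b b' db) (A : C) :
    dag P.act ▷ A ≫ (α_ (X ⊗ Y) X A).hom ≫ Pb.natPtr P.isotypicAct (X ⊗ A) =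
      (d : ℂ) • X ◁ Pb.ptr (unitProj (A ⊗ b)) := by
  have hn := P.isotypicAct_natural _ _ (α_ X A b).inv
  rw [← Category.assoc, natPtr, comp_ptr]
  have : (dag P.act ▷ A ≫ (α_ (X ⊗ Y) X A).hom) ▷ b ≫ (α_ (X ⊗ Y) (X ⊗ A) b).hom ≫
      P.isotypicAct ((X ⊗ A) ⊗ b) = (d : ℂ) • ((α_ X A b).hom ≫ X ◁ unitProj (A ⊗ b) ≫
        (α_ X A b).inv) := by
    calc _ = (α_ X A b).hom ≫ dag P.act ▷ (A ⊗ b) ≫ (α_ (X ⊗ Y) X (A ⊗ b)).hom ≫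
          (X ⊗ Y) ◁ (α_ X A b).inv ≫ P.isotypicAct ((X ⊗ A) ⊗ b) := by monoidal
      _ = (α_ X A b).hom ≫ (dag P.act ▷ (A ⊗ b) ≫ (α_ (X ⊗ Y) X (A ⊗ b)).hom ≫
          P.isotypicAct (X ⊗ A ⊗ b)) ≫ (α_ X A b).inv := by
        rw [hn]; simp only [Category.assoc]
      _ = _ := by
        rw [P.coact_isotypicAct]
        simp only [Linear.smul_comp, Linear.comp_smul]
  rw [this, ptr_smul, ptr_whiskerLeft]

lemma dag_isotypicAct_natPtr [Simple X] (P : BalancedPairing X Y d) {b b' : C} {db : ℝ}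
    (Pb : BalancedPairing b b' db) (B A : C) :
    dag (P.isotypicAct B) ▷ A ≫ (α_ (X ⊗ Y) B A).hom ≫ Pb.natPtr P.isotypicAct (B ⊗ A) =
      (d : ℂ) • (∑ i, onb B X i ≫ dag (onb B X i)) ▷ A ≫ B ◁ Pb.ptr (unitProj (A ⊗ b)) := by
  have hn := Pb.natPtr_natural P.isotypicAct_natural
  simp only [isotypicAct, dag_sum, sum_whiskerRight, Preadditive.sum_comp, Finset.smul_sum]
  refine Finset.sum_congr rfl fun i _ => ?_
  set w := onb B X i
  calc _ = w ▷ A ≫ dag P.act ▷ A ≫ (α_ (X ⊗ Y) X A).hom ≫ ((X ⊗ Y) ◁ (dag w ▷ A) ≫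
        Pb.natPtr P.isotypicAct (B ⊗ A)) := by
        simp only [dag_lemmas]; monoidal
    _ = w ▷ A ≫ (dag P.act ▷ A ≫ (α_ (X ⊗ Y) X A).hom ≫ Pb.natPtr P.isotypicAct (X ⊗ A)) ≫
        dag w ▷ A := by
        rw [hn]; simp only [Category.assoc]
    _ = _ := by
        rw [P.coact_natPtr]
        simp only [Linear.smul_comp, Linear.comp_smul, comp_whiskerRight, Category.assoc]
        rw [whisker_exchange]

lemma dag_natPtr_natPtr {k k' a a' b b' : C} {dk da db : ℝ} [Simple k]
    (P : BalancedPairing k k' dk) (Pa : BalancedPairing a a' da) (Pb : BalancedPairing b b' db)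
    (s j : C) :
    dag (Pa.natPtr P.isotypicAct s) ▷ j ≫ (α_ _ s j).hom ≫ Pb.natPtr P.isotypicAct (s ⊗ j) =
      Pa.ins s ▷ j ≫ (α_ (s ⊗ a) a' j).hom ≫
      (dag (P.isotypicAct (s ⊗ a)) ▷ (a' ⊗ j) ≫
      (α_ _ (s ⊗ a) (a' ⊗ j)).hom ≫ Pb.natPtr P.isotypicAct ((s ⊗ a) ⊗ (a' ⊗ j))) ≫
      (α_ (s ⊗ a) a' j).inv ≫ dag (Pa.ins s) ▷ j := by
  have e1 : dag (Pa.natPtr P.isotypicAct s) = Pa.ins s ≫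
      (dag (P.isotypicAct (s ⊗ a)) ≫ (α_ (k ⊗ k') s a).inv) ▷ a' ≫ dag (Pa.ins ((k ⊗ k') ⊗ s)) := by
    simp only [natPtr, ptr, dag_lemmas, Category.assoc]
  have e2 : dag (Pa.ins ((k ⊗ k') ⊗ s)) = (α_ (k ⊗ k') s a).hom ▷ a' ≫
      (α_ (k ⊗ k') (s ⊗ a) a').hom ≫ (k ⊗ k') ◁ dag (Pa.ins s) := by
    simp only [dag_ins]
    monoidal
  have n := Pb.natPtr_natural P.isotypicAct_natural
  rw [e1, e2]
  calc _ = Pa.ins s ▷ j ≫ dag (P.isotypicAct (s ⊗ a)) ▷ a' ▷ j ≫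
        (α_ (k ⊗ k') (s ⊗ a) a').hom ▷ j ≫ (α_ (k ⊗ k') ((s ⊗ a) ⊗ a') j).hom ≫
        (k ⊗ k') ◁ (dag (Pa.ins s) ▷ j) ≫ Pb.natPtr P.isotypicAct (s ⊗ j) := by monoidal
    _ = Pa.ins s ▷ j ≫ (α_ (s ⊗ a) a' j).hom ≫
        dag (P.isotypicAct (s ⊗ a)) ▷ (a' ⊗ j) ≫
        (α_ (k ⊗ k') (s ⊗ a) (a' ⊗ j)).hom ≫ ((k ⊗ k') ◁ (α_ (s ⊗ a) a' j).inv ≫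
        Pb.natPtr P.isotypicAct (((s ⊗ a) ⊗ a') ⊗ j)) ≫ dag (Pa.ins s) ▷ j := by
      rw [n]; monoidal
    _ = _ := by rw [n]; simp only [Category.assoc]

/-- Rotating the left leg of a trivalent vertex is a linear isomorphism. -/
noncomputable def rotate (P : BalancedPairing X Y d) (A B : C) :
    ((Y ⊗ A) ⊗ B ⟶ 𝟙_ C) ≃ₗ[ℂ] (A ⊗ B ⟶ X) where
  toFun y := (λ_ _).inv ≫ P.coev ▷ (A ⊗ B) ≫ (α_ _ _ _).hom ≫ X ◁ ((α_ _ _ _).inv ≫ y) ≫ (ρ_ X).hom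
  map_add' y z := by simp
  map_smul' c y := by simp
  invFun z := (α_ _ _ _).hom ≫ Y ◁ z ≫ P.ev
  left_inv y := by
    calc _ = 𝟙 _ ⊗≫ Y ◁ P.coev ▷ (A ⊗ B) ⊗≫ ((Y ⊗ X) ◁ ((α_ Y A B).inv ≫ y) ≫ P.ev ▷ (𝟙_ C))
          ⊗≫ 𝟙 _ := by monoidal
      _ = 𝟙 _ ⊗≫ (Y ◁ P.coev ⊗≫ P.ev ▷ Y) ▷ (A ⊗ B) ⊗≫ y := by
        rw [whisker_exchange]; monoidal
      _ = y := by rw [P.coev_ev]; monoidal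
  right_inv z := by
    calc _ = 𝟙 _ ⊗≫ (P.coev ▷ (A ⊗ B) ≫ (X ⊗ Y) ◁ z) ⊗≫ X ◁ P.ev ⊗≫ 𝟙 _ := by monoidal
      _ = z ⊗≫ (P.coev ▷ X ⊗≫ X ◁ P.ev) ⊗≫ 𝟙 _ := by
        rw [← whisker_exchange]; monoidal
      _ = z := by rw [P.ev_coev]; monoidal

lemma schurScalar_rotate [Simple X] (P : BalancedPairing X Y d) {A B : C}
    (y : (Y ⊗ A) ⊗ B ⟶ 𝟙_ C) :
    schurScalar X (dag (P.rotate A B y) ≫ P.rotate A B y) * d =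
      schurScalar (𝟙_ C) (dag y ≫ y) := by
  have h : (α_ _ _ _).hom ≫ Y ◁ P.rotate A B y ≫ P.ev = y := (P.rotate A B).symm_apply_apply y
  symm
  apply schurScalar_eq
  conv_lhs => rw [← h]
  simp only [dag_lemmas, Category.assoc, Iso.inv_hom_id_assoc]
  rw [← MonoidalCategory.whiskerLeft_comp_assoc]
  conv_lhs => rw [← schurScalar_smul_id (dag (P.rotate A B y) ≫ P.rotate A B y)]
  simp only [MonoidalLinear.whiskerLeft_smul, MonoidalCategory.whiskerLeft_id,
    Category.id_comp, Linear.smul_comp, Linear.comp_smul, P.ev_loop, smul_smul]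

lemma ptr_rotate (P : BalancedPairing X Y d) {A b b' : C} {db : ℝ} (Pb : BalancedPairing b b' db)
    (y : (Y ⊗ A) ⊗ b ⟶ 𝟙_ C) :
    (λ_ A).inv ≫ P.coev ▷ A ≫ (α_ X Y A).hom ≫ X ◁ Pb.ptr (y ≫ dag y) ≫ (α_ X Y A).inv ≫
      dag P.coev ▷ A ≫ (λ_ A).hom =
    Pb.ptr (P.rotate A b y ≫ dag (P.rotate A b y)) := by
  have hr : P.rotate A b y =
    (λ_ _).inv ≫ P.coev ▷ (A ⊗ b) ≫ (α_ _ _ _).hom ≫ X ◁ ((α_ _ _ _).inv ≫ y) ≫ (ρ_ X).hom := rfl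
  rw [hr]
  simp only [ptr, dag_ins]
  simp only [ins, dag_lemmas]
  calc _ = 𝟙 _ ⊗≫ (P.coev ▷ (A ⊗ 𝟙_ C) ≫ (X ⊗ Y) ◁ (A ◁ Pb.coev)) ⊗≫ X ◁ (y ≫ dag y) ▷ b' ⊗≫
        ((X ⊗ Y) ◁ (A ◁ dag Pb.coev) ≫ dag P.coev ▷ (A ⊗ 𝟙_ C)) ⊗≫ 𝟙 _ := by monoidal
    _ = _ := by
      rw [whisker_exchange (dag P.coev) (A ◁ dag Pb.coev),
        ← whisker_exchange P.coev (A ◁ Pb.coev)]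
      monoidal

lemma schurScalar_loop {a a' j j' b b' : C} {da dj db : ℝ} [Simple a] [Simple j] [Simple b]
    (Pa : BalancedPairing a a' da) (Pj : BalancedPairing j j' dj) (Pb : BalancedPairing b b' db) :
    (λ_ j).inv ≫ Pa.coev ▷ j ≫ (α_ a a' j).hom ≫ a ◁ Pb.ptr (unitProj ((a' ⊗ j) ⊗ b)) ≫
      (α_ a a' j).inv ≫ dag Pa.coev ▷ j ≫ (λ_ j).hom =
    ((Module.finrank ℂ (j ⊗ b ⟶ a) : ℂ) / dj) • 𝟙 j := by
  have hdj : (dj : ℂ) ≠ 0 := by exact_mod_cast Pj.pos.ne'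
  rw [unitProj, ptr_sum, whiskerLeft_sum]
  simp only [Preadditive.sum_comp, Preadditive.comp_sum, ptr_rotate]
  have : ∀ i, Pb.ptr (Pa.rotate j b (onb ((a' ⊗ j) ⊗ b) (𝟙_ C) i) ≫
      dag (Pa.rotate j b (onb ((a' ⊗ j) ⊗ b) (𝟙_ C) i))) = (1 / dj : ℂ) • 𝟙 j := by
    intro i
    rw [← schurScalar_smul_id (Pb.ptr _)]
    congr 1
    rw [eq_div_iff hdj, theta_eq Pj Pb Pa, schurScalar_rotate, dag_onb_comp_onb]
    simp
  simp only [this, Finset.sum_const, Finset.card_univ, Fintype.card_fin]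
  rw [(Pa.rotate j b).finrank_eq, ← Nat.cast_smul_eq_nsmul ℂ, smul_smul, mul_one_div]

end BalancedPairing

open BalancedPairing

variable {ι : Type*} [Fintype ι] {x : ι → C}

/-- The natural action of `x k ⊗ x k*` obtained by tracing out `x a`. -/
noncomputable def tracedAct (hx : IsSimpleList x) [∀ i, Simple (x i)] (k a : ι) (A : C) :
    (x k ⊗ x (dualIdx hx k)) ⊗ A ⟶ A :=
  (dualPairing hx a).natPtr (dualPairing hx k).isotypicAct A

lemma tracedAct_natural (hx : IsSimpleList x) [∀ i, Simple (x i)] (k a : ι) :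
    IsNaturalAction _ (tracedAct hx k a) :=
  natPtr_natural _ (isotypicAct_natural _)

lemma sum_dag_isotypicAct_tracedAct (hx : IsSimpleList x) [∀ i, Simple (x i)] (b : ι) (B A : C) :
    ∑ k, ((1 / quantumDim (x k) : ℝ) : ℂ) • (dag ((dualPairing hx k).isotypicAct B) ▷ A ≫
      (α_ _ B A).hom ≫ tracedAct hx k b (B ⊗ A)) =
      B ◁ (dualPairing hx b).ptr (unitProj (A ⊗ x b)) := by
  have hd : ∀ k, ((1 / quantumDim (x k) : ℝ) : ℂ) * (quantumDim (x k) : ℂ) = 1 := fun k => by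
    have := (quantumDim_pos hx k).ne'
    norm_cast
    field_simp
  simp only [tracedAct, dag_isotypicAct_natPtr, smul_smul, hd, one_smul]
  rw [← Preadditive.sum_comp, ← sum_whiskerRight, sum_onb_comp_dag_onb hx, id_whiskerRight,
    Category.id_comp]

lemma sum_dag_tracedAct_tracedAct (hx : IsSimpleList x) [∀ i, Simple (x i)] (a b j : ι) (s : C) :
    ∑ k, ((1 / quantumDim (x k) : ℝ) : ℂ) • (dag (tracedAct hx k a s) ▷ x j ≫
      (α_ _ s (x j)).hom ≫ tracedAct hx k b (s ⊗ x j)) =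
      ((Module.finrank ℂ (x j ⊗ x b ⟶ x a) : ℂ) / quantumDim (x j)) • 𝟙 (s ⊗ x j) := by
  let Pa := dualPairing hx a
  let a' := x (dualIdx hx a)
  have h1 : ∀ (k : ι) (c : ℂ), c • (dag (tracedAct hx k a s) ▷ x j ≫ (α_ _ s (x j)).hom ≫
      tracedAct hx k b (s ⊗ x j)) = Pa.ins s ▷ x j ≫ (α_ (s ⊗ x a) a' (x j)).hom ≫
      (c • (dag ((dualPairing hx k).isotypicAct (s ⊗ x a)) ▷ (a' ⊗ x j) ≫
      (α_ _ (s ⊗ x a) (a' ⊗ x j)).hom ≫ tracedAct hx k b ((s ⊗ x a) ⊗ (a' ⊗ x j)))) ≫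
      (α_ (s ⊗ x a) a' (x j)).inv ≫ dag (Pa.ins s) ▷ x j := by
    intro k c
    simp only [Linear.smul_comp, Linear.comp_smul]
    congr 1
    exact dag_natPtr_natPtr _ _ _ _ _
  simp only [h1]
  simp only [← Preadditive.sum_comp, ← Preadditive.comp_sum]
  rw [sum_dag_isotypicAct_tracedAct]
  have h2 := schurScalar_loop Pa (dualPairing hx j) (dualPairing hx b)
  calc _ = s ◁ ((λ_ (x j)).inv ≫ Pa.coev ▷ x j ≫ (α_ (x a) a' (x j)).hom ≫
        x a ◁ (dualPairing hx b).ptr (unitProj ((a' ⊗ x j) ⊗ x b)) ≫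
        (α_ (x a) a' (x j)).inv ≫ dag Pa.coev ▷ x j ≫ (λ_ (x j)).hom) := by
        simp only [dag_ins]
        simp only [ins]
        monoidal
    _ = _ := by
        rw [h2]
        simp only [MonoidalLinear.whiskerLeft_smul, MonoidalCategory.whiskerLeft_id]

end NaturalActions

section HandleSlide

open UnitaryCategory DaggerCategory UnitaryFusionCategory BalancedPairing

lemma sesquilinear_ext {V : Type*} [AddCommGroup V] [Module ℂ V] (S T : V → V → ℂ)
    (hS : ∀ y y' z, S (y + y') z = S y z + S y' z) (hS' : ∀ y z z', S y (z + z') = S y z + S y z')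
    (hSc : ∀ (c : ℂ) y z, S (c • y) z = c * S y z)
    (hSc' : ∀ (c : ℂ) y z, S y (c • z) = conj c * S y z)
    (hT : ∀ y y' z, T (y + y') z = T y z + T y' z) (hT' : ∀ y z z', T y (z + z') = T y z + T y z')
    (hTc : ∀ (c : ℂ) y z, T (c • y) z = c * T y z)
    (hTc' : ∀ (c : ℂ) y z, T y (c • z) = conj c * T y z)
    (h : ∀ y, S y y = T y y) (y z : V) : S y z = T y z := by
  have h1 := h (y + z)
  have h2 := h (y + Complex.I • z)
  have hy := h y
  have hz := h z
  simp only [hS, hS', hSc, hSc', hT, hT', hTc, hTc', Complex.conj_I] at h1 h2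
  have hI := Complex.I_mul_I
  linear_combination (1 / 2 : ℂ) * h1 + (Complex.I / 2) * h2 - ((1 + Complex.I) / 2) * hy -
    ((1 - Complex.I ^ 3) / 2) * hz + (1 / 2) * (S y z - S z y - (T y z - T z y)) * hI

variable {C : Type u} [Category.{v} C] [Abelian C] [Linear ℂ C] [MonoidalCategory C]
  [MonoidalPreadditive C] [MonoidalLinear ℂ C] [RigidCategory C] [UnitaryCategory C]
  [UnitaryFusionCategory C]

namespace BalancedPairing

variable {X Y : C} {d : ℝ}

/-- Bending the left leg of `f : Y ⊗ A ⟶ B` upwards. -/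
def leftBend (P : BalancedPairing X Y d) {A B : C} (f : Y ⊗ A ⟶ B) : A ⟶ X ⊗ B :=
  (λ_ A).inv ≫ P.coev ▷ A ≫ (α_ X Y A).hom ≫ X ◁ f

/-- Bending the left leg of `g : A ⟶ X ⊗ B` downwards. -/
def leftUnbend (P : BalancedPairing X Y d) {A B : C} (g : A ⟶ X ⊗ B) : Y ⊗ A ⟶ B :=
  Y ◁ g ≫ (α_ Y X B).inv ≫ P.ev ▷ B ≫ (λ_ B).hom

lemma leftUnbend_leftBend (P : BalancedPairing X Y d) {A B : C} (f : Y ⊗ A ⟶ B) :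
    P.leftUnbend (P.leftBend f) = f :=
  letI := P.toExactPairing
  (tensorLeftHomEquiv A X Y B).left_inv f

lemma leftBend_leftUnbend (P : BalancedPairing X Y d) {A B : C} (g : A ⟶ X ⊗ B) :
    P.leftBend (P.leftUnbend g) = g :=
  letI := P.toExactPairing
  (tensorLeftHomEquiv A X Y B).right_inv g

/-- Bending the right leg of `g : A ⟶ B ⊗ Y` downwards. -/
def unbend (P : BalancedPairing X Y d) {A B : C} (g : A ⟶ B ⊗ Y) : A ⊗ X ⟶ B :=
  g ▷ X ≫ (α_ B Y X).hom ≫ B ◁ P.ev ≫ (ρ_ B).hom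

lemma bend_unbend (P : BalancedPairing X Y d) {A B : C} (g : A ⟶ B ⊗ Y) :
    P.bend (P.unbend g) = g := by
  let _ := P.toExactPairing
  have := (tensorRightHomEquiv A X Y B).right_inv g
  refine Eq.trans ?_ this
  simp only [bend, ins, Category.assoc]
  rfl

end BalancedPairing

section

variable {s s' j j' t t' : C} {ds dj dt : ℝ} [Simple s] [Simple j] [Simple t] [Simple j']

/-- A trivalent vertex `s ⊗ j ⟶ t` seen as a morphism `t' ⊗ s ⟶ j'`. -/
def flipVertex (Pj : BalancedPairing j j' dj) (Pt : BalancedPairing t t' dt) :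
    (s ⊗ j ⟶ t) →ₗ[ℂ] (t' ⊗ s ⟶ j') where
  toFun h := Pt.leftUnbend (Pj.bend h)
  map_add' h h' := by simp [bend, leftUnbend]
  map_smul' c h := by simp [bend, leftUnbend]

lemma flipVertex_apply (Pj : BalancedPairing j j' dj) (Pt : BalancedPairing t t' dt)
    (h : s ⊗ j ⟶ t) : flipVertex Pj Pt h = Pt.leftUnbend (Pj.bend h) := rfl

lemma bend_eq_leftBend_flipVertex (Pj : BalancedPairing j j' dj) (Pt : BalancedPairing t t' dt)
    (h : s ⊗ j ⟶ t) : Pj.bend h = Pt.leftBend (flipVertex Pj Pt h) := by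
  rw [flipVertex_apply, leftBend_leftUnbend]

lemma flipVertex_surjective (Pj : BalancedPairing j j' dj) (Pt : BalancedPairing t t' dt) :
    Function.Surjective (flipVertex (s := s) Pj Pt) := fun f =>
  ⟨Pj.unbend (Pt.leftBend f), by rw [flipVertex_apply, bend_unbend, leftUnbend_leftBend]⟩

lemma schurScalar_flipVertex_self (Ps : BalancedPairing s s' ds) (Pj : BalancedPairing j j' dj)
    (Pt : BalancedPairing t t' dt) (h : s ⊗ j ⟶ t) :
    schurScalar j' (dag (flipVertex Pj Pt h) ≫ flipVertex Pj Pt h) * dj =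
      schurScalar t (dag h ≫ h) * dt := by
  have := Pt.simple_dual
  set f := flipVertex Pj Pt h with hf
  have hb := bend_eq_leftBend_flipVertex Pj Pt h
  have h1 := theta_eq Pt.symm Ps Pj.symm f
  have h2 := ptr_schurScalar_mul Pt.symm Ps (f ≫ dag f)
  have h3 := theta_eq Ps Pj Pt h
  rw [← h1, h2, ← h3, ← bend_comp_dag_bend, hb, ← hf]
  congr 2
  simp only [leftBend, symm_ev, dag_lemmas, Category.assoc, MonoidalCategory.whiskerLeft_comp]

lemma schurScalar_flipVertex (Ps : BalancedPairing s s' ds) (Pj : BalancedPairing j j' dj)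
    (Pt : BalancedPairing t t' dt) (h g : s ⊗ j ⟶ t) :
    schurScalar j' (dag (flipVertex Pj Pt h) ≫ flipVertex Pj Pt g) * dj =
      schurScalar t (dag h ≫ g) * dt := by
  refine sesquilinear_ext
    (fun g h => schurScalar j' (dag (flipVertex Pj Pt h) ≫ flipVertex Pj Pt g) * dj)
    (fun g h => schurScalar t (dag h ≫ g) * dt) ?_ ?_ ?_ ?_ ?_ ?_ ?_ ?_
    (fun h => schurScalar_flipVertex_self Ps Pj Pt h) g h <;> intros <;>
  simp only [map_add, map_smul, dag_add, dag_smul, Preadditive.comp_add,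
    Preadditive.add_comp, Linear.smul_comp, Linear.comp_smul, smul_eq_mul] <;>
  ring

end

variable {ι : Type*} [Fintype ι] {x : ι → C}

lemma sum_flipVertex_onb (hx : IsSimpleList x) [∀ i, Simple (x i)] (s t : ι) :
    ∑ j, (quantumDim (x j) : ℂ) • ∑ i,
      flipVertex (dualPairing hx j) (dualPairing hx t) (onb (x s ⊗ x j) (x t) i) ≫
      dag (flipVertex (dualPairing hx j) (dualPairing hx t) (onb (x s ⊗ x j) (x t) i)) =
    (quantumDim (x t) : ℂ) • 𝟙 (x (dualIdx hx t) ⊗ x s) := by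
  have hd : ∀ k, (quantumDim (x k) : ℂ) ≠ 0 := fun k => by
    exact_mod_cast (quantumDim_pos hx k).ne'
  have key := sum_comp_dag_eq_id hx (dualIdx_involutive hx).bijective
    (fun j i => flipVertex (dualPairing hx j) (dualPairing hx t) (onb (x s ⊗ x j) (x t) i))
    (fun j => (quantumDim (x j) : ℂ) / quantumDim (x t)) ?_
  · rw [← key, Finset.smul_sum]
    refine Finset.sum_congr rfl fun j _ => ?_
    rw [smul_smul, mul_div_cancel₀ _ (hd t)]
  · intro j f
    obtain ⟨g, rfl⟩ := flipVertex_surjective (s := x s) (dualPairing hx j) (dualPairing hx t) f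
    conv_rhs => rw [← sum_onb_comp g, map_sum]
    rw [Finset.smul_sum]
    refine Finset.sum_congr rfl fun i _ => ?_
    set h := onb (x s ⊗ x j) (x t) i
    have e := schurScalar_flipVertex (dualPairing hx s) (dualPairing hx j) (dualPairing hx t) h g
    rw [← schurScalar_smul_id (dag h ≫ g),
      ← schurScalar_smul_id (dag (flipVertex _ _ h) ≫ flipVertex _ _ g)]
    simp only [Linear.comp_smul, Category.comp_id, map_smul, smul_smul]
    congr 1
    rw [div_mul_eq_mul_div, div_eq_iff (hd t), ← e, mul_comm]

/-- Closing up the strand of `X` in an action `Z ⊗ X ⟶ X`. -/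
def BalancedPairing.close {X Y Z : C} {d : ℝ} (P : BalancedPairing X Y d) (f : Z ⊗ X ⟶ X) :
    Z ⟶ 𝟙_ C :=
  P.ins Z ≫ f ▷ Y ≫ dag P.coev

/-- Sliding a strand over the weighted sum of all loops. -/
lemma sum_natPtr (hx : IsSimpleList x) [∀ i, Simple (x i)] {Z : C} {ξ : ∀ A : C, Z ⊗ A ⟶ A}
    (hξ : IsNaturalAction Z ξ) (s : ι) :
    ∑ j, (quantumDim (x j) : ℂ) • (dualPairing hx j).natPtr ξ (x s) =
      (∑ t, (quantumDim (x t) : ℂ) • (dualPairing hx t).close (ξ (x t))) ▷ x s ≫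
        (λ_ (x s)).hom := by
  have h1 : ∀ j, (dualPairing hx j).natPtr ξ (x s) = ∑ t, ∑ i,
      Z ◁ ((λ_ (x s)).inv ≫ (dualPairing hx t).coev ▷ x s ≫ (α_ _ _ _).hom) ≫ (α_ _ _ _).inv ≫
      (Z ⊗ x t) ◁ (flipVertex (dualPairing hx j) (dualPairing hx t) (onb (x s ⊗ x j) (x t) i) ≫
      dag (flipVertex (dualPairing hx j) (dualPairing hx t) (onb (x s ⊗ x j) (x t) i))) ≫
      ξ (x t) ▷ _ ≫ (α_ _ _ _).inv ≫ dag (dualPairing hx t).coev ▷ x s ≫ (λ_ (x s)).hom := by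
    intro j
    have e1 : ξ (x s ⊗ x j) = ∑ t, ∑ i, Z ◁ onb (x s ⊗ x j) (x t) i ≫ ξ (x t) ≫
        dag (onb (x s ⊗ x j) (x t) i) := by
      rw [← Category.comp_id (ξ (x s ⊗ x j)), ← sum_onb_comp_dag_onb hx]
      simp only [Preadditive.comp_sum]
      refine Finset.sum_congr rfl fun t _ => Finset.sum_congr rfl fun i _ => ?_
      rw [← Category.assoc, ← hξ, Category.assoc]
    rw [natPtr, e1]
    simp only [Preadditive.comp_sum, ptr_sum]
    refine Finset.sum_congr rfl fun t _ => Finset.sum_congr rfl fun i _ => ?_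
    set h := onb (x s ⊗ x j) (x t) i
    have hb := bend_eq_leftBend_flipVertex (dualPairing hx j) (dualPairing hx t) h
    set f := flipVertex (dualPairing hx j) (dualPairing hx t) h
    calc _ = Z ◁ (dualPairing hx j).bend h ≫ (α_ _ _ _).inv ≫ ξ (x t) ▷ x (dualIdx hx j) ≫
          dag ((dualPairing hx j).bend h) := by
          simp only [ptr, bend, dag_lemmas]
          simp only [ins]
          monoidal
      _ = Z ◁ ((λ_ (x s)).inv ≫ (dualPairing hx t).coev ▷ x s ≫ (α_ _ _ _).hom) ≫
          (α_ _ _ _).inv ≫ (Z ⊗ x t) ◁ f ≫ (ξ (x t) ▷ x (dualIdx hx j) ≫ x t ◁ dag f) ≫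
          (α_ _ _ _).inv ≫ dag (dualPairing hx t).coev ▷ x s ≫ (λ_ (x s)).hom := by
          rw [hb]
          simp only [leftBend, dag_lemmas]
          monoidal
      _ = _ := by
          rw [← whisker_exchange]
          monoidal
  have h2 : ∀ t, (quantumDim (x t) : ℂ) • ((dualPairing hx t).close (ξ (x t)) ▷ x s ≫
      (λ_ (x s)).hom) = ∑ j, (quantumDim (x j) : ℂ) • ∑ i,
      Z ◁ ((λ_ (x s)).inv ≫ (dualPairing hx t).coev ▷ x s ≫ (α_ _ _ _).hom) ≫ (α_ _ _ _).inv ≫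
      (Z ⊗ x t) ◁ (flipVertex (dualPairing hx j) (dualPairing hx t) (onb (x s ⊗ x j) (x t) i) ≫
      dag (flipVertex (dualPairing hx j) (dualPairing hx t) (onb (x s ⊗ x j) (x t) i))) ≫
      ξ (x t) ▷ _ ≫ (α_ _ _ _).inv ≫ dag (dualPairing hx t).coev ▷ x s ≫ (λ_ (x s)).hom := by
    intro t
    let Φ : (x (dualIdx hx t) ⊗ x s ⟶ x (dualIdx hx t) ⊗ x s) →ₗ[ℂ] (Z ⊗ x s ⟶ x s) :=
      { toFun := fun g =>
          Z ◁ ((λ_ (x s)).inv ≫ (dualPairing hx t).coev ▷ x s ≫ (α_ _ _ _).hom) ≫ (α_ _ _ _).inv ≫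
          (Z ⊗ x t) ◁ g ≫ ξ (x t) ▷ _ ≫ (α_ _ _ _).inv ≫ dag (dualPairing hx t).coev ▷ x s ≫
          (λ_ (x s)).hom
        map_add' := fun g g' => by
          simp only [MonoidalPreadditive.whiskerLeft_add, Preadditive.add_comp,
            Preadditive.comp_add]
        map_smul' := fun c g => by
          simp only [MonoidalLinear.whiskerLeft_smul, Linear.smul_comp, Linear.comp_smul,
            RingHom.id_apply] }
    have e := congrArg Φ (sum_flipVertex_onb hx s t)
    simp only [map_sum, map_smul] at e
    refine Eq.trans ?_ e.symm
    congr 1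
    simp only [Φ, LinearMap.coe_mk, AddHom.coe_mk, close, ins]
    monoidal
  simp only [h1, sum_whiskerRight, Preadditive.sum_comp, MonoidalLinear.smul_whiskerRight,
    Linear.smul_comp, h2, Finset.smul_sum]
  exact Finset.sum_comm

end HandleSlide

section PositiveKernels

open UnitaryCategory DaggerCategory UnitaryFusionCategory BalancedPairing

variable {C : Type u} [Category.{v} C] [Abelian C] [Linear ℂ C] [MonoidalCategory C]
  [MonoidalPreadditive C] [MonoidalLinear ℂ C] [RigidCategory C] [UnitaryCategory C]
  [UnitaryFusionCategory C]

lemma schurScalar_dag_comp_whiskerRight {X Y Z : C} {d : ℝ} [Simple X] (P : BalancedPairing X Y d)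
    (f : Z ⊗ X ⟶ X) (K : Z ⟶ 𝟙_ C) :
    schurScalar X (dag f ≫ K ▷ X ≫ (λ_ X).hom) * d = schurScalar (𝟙_ C) (dag (P.close f) ≫ K) := by
  symm
  apply schurScalar_eq
  calc dag (P.close f) ≫ K
      = 𝟙 _ ⊗≫ P.coev ⊗≫ dag f ▷ Y ⊗≫ (Z ◁ dag P.coev ≫ K ▷ (𝟙_ C)) ⊗≫ 𝟙 _ := by
        simp only [close, dag_lemmas]
        simp only [dag_ins]
        monoidal
    _ = P.coev ≫ (dag f ≫ K ▷ X ≫ (λ_ X).hom) ▷ Y ≫ dag P.coev := by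
        rw [whisker_exchange K (dag P.coev)]
        monoidal
    _ = _ := by
        conv_lhs => rw [← schurScalar_smul_id (dag f ≫ K ▷ X ≫ (λ_ X).hom)]
        simp only [MonoidalLinear.smul_whiskerRight, id_whiskerRight,
          Category.id_comp, Linear.smul_comp, Linear.comp_smul, P.coev_loop, smul_smul]

variable {ι : Type*} [Fintype ι] {x : ι → C}

/-- The scalar obtained from two natural actions by pairing them on `x s` and tracing out `x j`. -/
noncomputable def actPair (hx : IsSimpleList x) [∀ i, Simple (x i)] (j s : ι) {Z : C}
    (ξ ξ' : ∀ A : C, Z ⊗ A ⟶ A) : ℂ :=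
  schurScalar (x s) (dag (ξ (x s)) ≫ (dualPairing hx j).natPtr ξ' (x s))

/-- A family of kernels is positive when it is positive against all families of natural actions. -/
def IsPosKernel (hx : IsSimpleList x) [∀ i, Simple (x i)] {I : Type*} [Fintype I]
    (K : ι → I → I → ℂ) : Prop :=
  ∀ (Z : C) (ξ : I → ∀ A : C, Z ⊗ A ⟶ A), (∀ i, IsNaturalAction Z (ξ i)) →
    0 ≤ ∑ i, ∑ i', ∑ j, ∑ s, (quantumDim (x j) : ℂ) * (quantumDim (x s) : ℂ) ^ 2 * K j i i' *
      actPair hx j s (ξ i) (ξ i')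

lemma isPosKernel_one (hx : IsSimpleList x) [∀ i, Simple (x i)] {I : Type*} [Fintype I] :
    IsPosKernel hx (fun _ (_ _ : I) => 1) := by
  intro Z ξ hξ
  set K : I → (Z ⟶ 𝟙_ C) := fun i =>
    ∑ t, (quantumDim (x t) : ℂ) • (dualPairing hx t).close (ξ i (x t)) with hK
  have h : ∀ i i', ∑ j, ∑ s, (quantumDim (x j) : ℂ) * (quantumDim (x s) : ℂ) ^ 2 * 1 *
      actPair hx j s (ξ i) (ξ i') = schurScalar (𝟙_ C) (dag (K i) ≫ K i') := by
    intro i i'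
    rw [Finset.sum_comm]
    have e : ∀ s, ∑ j, (quantumDim (x j) : ℂ) * (quantumDim (x s) : ℂ) ^ 2 * 1 *
        actPair hx j s (ξ i) (ξ i') = (quantumDim (x s) : ℂ) *
        schurScalar (𝟙_ C) (dag ((dualPairing hx s).close (ξ i (x s))) ≫ K i') := by
      intro s
      rw [← schurScalar_dag_comp_whiskerRight, ← sum_natPtr hx (hξ i'), Preadditive.comp_sum,
        map_sum, Finset.sum_mul, Finset.mul_sum]
      refine Finset.sum_congr rfl fun j _ => ?_
      rw [Linear.comp_smul, map_smul, smul_eq_mul, actPair]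
      ring
    simp only [e]
    simp only [hK, dag_sum, dag_smul, Preadditive.sum_comp, map_sum, Linear.smul_comp, map_smul,
      Complex.conj_ofReal, smul_eq_mul]
  simp only [h]
  have h' : ∑ i, ∑ i', schurScalar (𝟙_ C) (dag (K i) ≫ K i') =
      schurScalar (𝟙_ C) (dag (∑ i, K i) ≫ ∑ i, K i) := by
    simp only [dag_sum, Preadditive.sum_comp, Preadditive.comp_sum, map_sum]
    exact Finset.sum_comm
  rw [h']
  exact schurScalar_dag_comp_nonneg _

lemma IsPosKernel.congr {hx : IsSimpleList x} [∀ i, Simple (x i)] {I J : Type*} [Fintype I]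
    [Fintype J] {K : ι → I → I → ℂ} (h : IsPosKernel hx K) (e : I ≃ J) {L : ι → J → J → ℂ}
    (hL : ∀ j a b, L j (e a) (e b) = K j a b) : IsPosKernel hx L := by
  intro Z ξ hξ
  have := h Z (fun i => ξ (e i)) (fun i => hξ _)
  rw [← e.sum_comp]
  simp_rw [← e.sum_comp (fun i' => ∑ j, ∑ s, (quantumDim (x j) : ℂ) * (quantumDim (x s) : ℂ) ^ 2 *
    L j (e _) i' * actPair hx j s (ξ (e _)) (ξ i')), hL]
  exact this

/-- The action of `Z ⊗ W` obtained by composing actions of `W` and `Z`. -/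
def actComp {Z W : C} (ω : ∀ A : C, W ⊗ A ⟶ A) (ξ : ∀ A : C, Z ⊗ A ⟶ A) (A : C) :
    (Z ⊗ W) ⊗ A ⟶ A :=
  (α_ Z W A).hom ≫ Z ◁ ω A ≫ ξ A

lemma actComp_natural {Z W : C} {ω : ∀ A : C, W ⊗ A ⟶ A} {ξ : ∀ A : C, Z ⊗ A ⟶ A}
    (hω : IsNaturalAction W ω) (hξ : IsNaturalAction Z ξ) :
    IsNaturalAction (Z ⊗ W) (actComp ω ξ) := by
  intro A B f
  simp only [actComp, Category.assoc, ← hξ A B f]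
  rw [← MonoidalCategory.whiskerLeft_comp_assoc Z (ω A), ← hω A B f]
  monoidal

lemma IsNaturalAction.sum {Z : C} {I : Type*} [Fintype I] {ξ : I → ∀ A : C, Z ⊗ A ⟶ A}
    (h : ∀ i, IsNaturalAction Z (ξ i)) : IsNaturalAction Z (fun A => ∑ i, ξ i A) := by
  intro A B f
  simp only [Preadditive.comp_sum, Preadditive.sum_comp, h _ A B f]

lemma actPair_sum_sum (hx : IsSimpleList x) [∀ i, Simple (x i)] (j s : ι) {Z : C} {I : Type*}
    [Fintype I] (ξ ξ' : I → ∀ A : C, Z ⊗ A ⟶ A) :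
    actPair hx j s (fun A => ∑ i, ξ i A) (fun A => ∑ i, ξ' i A) =
      ∑ i, ∑ i', actPair hx j s (ξ i) (ξ' i') := by
  simp only [actPair, natPtr, Preadditive.comp_sum, ptr_sum, dag_sum, Preadditive.sum_comp, map_sum]
  exact Finset.sum_comm

lemma sum_actPair_actComp (hx : IsSimpleList x) [∀ i, Simple (x i)] (j s a b : ι) {Z : C}
    (ξ ξ' : ∀ A : C, Z ⊗ A ⟶ A) :
    ∑ k, ((1 / quantumDim (x k) : ℝ) : ℂ) * actPair hx j s (actComp (tracedAct hx k a) ξ)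
      (actComp (tracedAct hx k b) ξ') =
    ((Module.finrank ℂ (x j ⊗ x b ⟶ x a) : ℂ) / quantumDim (x j)) * actPair hx j s ξ ξ' := by
  have h1 : ∀ k, actPair hx j s (actComp (tracedAct hx k a) ξ) (actComp (tracedAct hx k b) ξ') =
      schurScalar (x s) ((dualPairing hx j).ptr (dag (ξ (x s)) ▷ x j ≫ (α_ Z (x s) (x j)).hom ≫
      Z ◁ (dag (tracedAct hx k a (x s)) ▷ x j ≫ (α_ _ (x s) (x j)).hom ≫
        tracedAct hx k b (x s ⊗ x j)) ≫ ξ' (x s ⊗ x j))) := by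
    intro k
    rw [actPair, natPtr, comp_ptr]
    congr 2
    simp only [actComp, dag_lemmas]
    monoidal
  let Φ : (x s ⊗ x j ⟶ x s ⊗ x j) →ₗ[ℂ] ℂ :=
    { toFun := fun g => schurScalar (x s) ((dualPairing hx j).ptr (dag (ξ (x s)) ▷ x j ≫
        (α_ Z (x s) (x j)).hom ≫ Z ◁ g ≫ ξ' (x s ⊗ x j)))
      map_add' := fun g g' => by
        simp only [MonoidalPreadditive.whiskerLeft_add, Preadditive.add_comp, Preadditive.comp_add,
          BalancedPairing.ptr, comp_whiskerRight, MonoidalPreadditive.add_whiskerRight, map_add]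
      map_smul' := fun c g => by
        simp only [MonoidalLinear.whiskerLeft_smul, Linear.smul_comp, Linear.comp_smul, ptr_smul,
          map_smul, RingHom.id_apply] }
  have e := congrArg Φ (sum_dag_tracedAct_tracedAct hx a b j (x s))
  simp only [map_sum, map_smul, smul_eq_mul] at e
  simp only [h1]
  refine e.trans ?_
  rw [actPair, natPtr, comp_ptr]
  simp only [Φ, LinearMap.coe_mk, AddHom.coe_mk, MonoidalCategory.whiskerLeft_id, Category.id_comp]

lemma sum_rotate {α β γ : Type*} [Fintype α] [Fintype β] [Fintype γ] (F : α → β → γ → ℂ) :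
    ∑ a, ∑ b, ∑ c, F a b c = ∑ c, ∑ a, ∑ b, F a b c := by
  rw [Finset.sum_comm (s := (Finset.univ : Finset γ))]
  exact Finset.sum_congr rfl fun a _ => Finset.sum_comm

lemma sum_comm_pairs {α β : Type*} [Fintype α] [Fintype β] (F : α → β → α → β → α → α → α → ℂ) :
    ∑ a, ∑ i, ∑ b, ∑ i', ∑ j, ∑ s, ∑ k, F a i b i' j s k =
      ∑ k, ∑ i, ∑ i', ∑ j, ∑ s, ∑ a, ∑ b, F a i b i' j s k := by
  rw [Finset.sum_comm, ← sum_rotate (fun i i' k => ∑ j, ∑ s, ∑ a, ∑ b, F a i b i' j s k)]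
  refine Finset.sum_congr rfl fun i _ => ?_
  rw [sum_rotate]
  refine Finset.sum_congr rfl fun i' _ => ?_
  rw [sum_rotate, ← sum_rotate (fun j s k => ∑ a, ∑ b, F a i b i' j s k)]
  refine Finset.sum_congr rfl fun j _ => ?_
  rw [sum_rotate]
  exact Finset.sum_congr rfl fun s _ => sum_rotate _

lemma IsPosKernel.prod {hx : IsSimpleList x} [∀ i, Simple (x i)] {I : Type*} [Fintype I]
    {K : ι → I → I → ℂ} (h : IsPosKernel hx K) :
    IsPosKernel hx (fun j (p q : ι × I) =>
      (Module.finrank ℂ (x j ⊗ x q.1 ⟶ x p.1) : ℂ) / quantumDim (x j) * K j p.2 q.2) := by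
  intro Z ξ hξ
  have hk := fun k => h (Z ⊗ (x k ⊗ x (dualIdx hx k)))
    (fun i A => ∑ a, actComp (tracedAct hx k a) (ξ (a, i)) A)
    (fun i => IsNaturalAction.sum fun a => actComp_natural (tracedAct_natural hx k a) (hξ _))
  have h0 : ∀ k, (0 : ℂ) ≤ ((1 / quantumDim (x k) : ℝ) : ℂ) := fun k => by
    have := quantumDim_pos hx k
    exact_mod_cast (by positivity : (0 : ℝ) ≤ 1 / quantumDim (x k))
  have key := Finset.sum_nonneg fun k (_ : k ∈ Finset.univ) => mul_nonneg (h0 k) (hk k)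
  convert key using 1
  simp only [actPair_sum_sum]
  simp only [Finset.mul_sum]
  have e : ∀ (a b j s : ι) (i i' : I), (quantumDim (x j) : ℂ) * (quantumDim (x s) : ℂ) ^ 2 *
      ((Module.finrank ℂ (x j ⊗ x b ⟶ x a) : ℂ) / quantumDim (x j) * K j i i') *
      actPair hx j s (ξ (a, i)) (ξ (b, i')) = ∑ k, ((1 / quantumDim (x k) : ℝ) : ℂ) *
      ((quantumDim (x j) : ℂ) * (quantumDim (x s) : ℂ) ^ 2 * K j i i' *
      actPair hx j s (actComp (tracedAct hx k a) (ξ (a, i)))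
        (actComp (tracedAct hx k b) (ξ (b, i')))) := by
    intro a b j s i i'
    calc _ = (quantumDim (x j) : ℂ) * (quantumDim (x s) : ℂ) ^ 2 * K j i i' *
          ((Module.finrank ℂ (x j ⊗ x b ⟶ x a) : ℂ) / quantumDim (x j) *
          actPair hx j s (ξ (a, i)) (ξ (b, i'))) := by ring
      _ = _ := by
        rw [← sum_actPair_actComp, Finset.mul_sum]
        exact Finset.sum_congr rfl fun k _ => by ring
  simp only [Fintype.sum_prod_type, e]
  exact sum_comm_pairs _

/-- Iterating the product with the fusion kernel. -/
lemma isPosKernel_prod_fusion (hx : IsSimpleList x) [∀ i, Simple (x i)] (n : ℕ) :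
    IsPosKernel hx (fun j (a b : Fin n → ι) =>
      ∏ i, ((Module.finrank ℂ (x j ⊗ x (b i) ⟶ x (a i)) : ℂ) / quantumDim (x j))) := by
  induction n with
  | zero => simpa using isPosKernel_one hx
  | succ n ih =>
    refine ih.prod.congr (Fin.consEquiv fun _ => ι) fun j a b => ?_
    rw [Fin.prod_univ_succ]
    rfl

lemma smul_leftUnitor_natural (c : ℂ) :
    IsNaturalAction (𝟙_ C) (fun A => c • (λ_ A).hom) := by
  intro A B f
  simp only [Linear.comp_smul, Linear.smul_comp, leftUnitor_naturality]

lemma actPair_smul_leftUnitor (hx : IsSimpleList x) [∀ i, Simple (x i)] (j s : ι) (c c' : ℂ) :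
    actPair hx j s (fun A : C => c • (λ_ A).hom) (fun A : C => c' • (λ_ A).hom) =
      conj c * c' * quantumDim (x j) := by
  rw [actPair, natPtr, comp_ptr]
  have : dag (c • (λ_ (x s)).hom) ▷ x j ≫ (α_ _ _ _).hom ≫ (c' • (λ_ (x s ⊗ x j)).hom) =
      (conj c * c') • 𝟙 (x s ⊗ x j) := by
    simp only [dag_smul, dag_lemmas, MonoidalLinear.smul_whiskerRight, Linear.comp_smul,
      Linear.smul_comp, smul_smul, mul_comm]
    congr 1
    monoidal
  rw [this, ptr_smul, ptr_id, smul_smul, map_smul, schurScalar_id, smul_eq_mul, mul_one]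

lemma sum_conj_mul_nonneg (hx : IsSimpleList x) (n : ℕ) (c : (Fin n → ι) → ℂ) :
    0 ≤ ∑ a, ∑ b, conj (c a) * (∑ j, ((quantumDim (x j) ^ (-(n : ℤ) + 2) : ℝ) : ℂ) *
      ∏ i, (Module.finrank ℂ (x j ⊗ x (b i) ⟶ x (a i)) : ℂ)) * c b := by
  let _ := hx.simple
  have h := isPosKernel_prod_fusion hx n (𝟙_ C) (fun a A => c a • (λ_ A).hom)
    (fun a => smul_leftUnitor_natural _)
  simp only [actPair_smul_leftUnitor] at h
  obtain ⟨i₀, _⟩ := hx.complete (𝟙_ C) inferInstance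
  have hD : 0 < ∑ s, quantumDim (x s) ^ 2 :=
    Finset.sum_pos (fun s _ => pow_pos (quantumDim_pos hx s) 2) ⟨i₀, Finset.mem_univ _⟩
  have hD' : (0 : ℂ) < ((∑ s, quantumDim (x s) ^ 2 : ℝ) : ℂ) := by exact_mod_cast hD
  rw [← inv_mul_cancel_left₀ hD'.ne' (∑ a, _)]
  refine mul_nonneg (inv_nonneg.2 hD'.le) ?_
  convert h using 1
  rw [Finset.mul_sum]
  refine Finset.sum_congr rfl fun a _ => ?_
  rw [Finset.mul_sum]
  refine Finset.sum_congr rfl fun b _ => ?_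
  rw [Finset.mul_sum, Finset.sum_mul, Finset.mul_sum]
  refine Finset.sum_congr rfl fun j _ => ?_
  push_cast
  rw [Finset.sum_mul]
  refine Finset.sum_congr rfl fun s _ => ?_
  have hj : (quantumDim (x j) : ℂ) ≠ 0 := by exact_mod_cast (quantumDim_pos hx j).ne'
  rw [Finset.prod_div_distrib, Finset.prod_const, Finset.card_univ, Fintype.card_fin, zpow_add₀ hj,
    zpow_neg, zpow_natCast]
  field_simp

end PositiveKernels

section ModuleCategories

open UnitaryCategory DaggerCategory UnitaryFusionCategory UnitaryModuleCategory
open scoped MonoidalLeftAction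

variable {C : Type u} [Category.{v} C] [Abelian C] [Linear ℂ C] [MonoidalCategory C]
  [MonoidalPreadditive C] [MonoidalLinear ℂ C] [RigidCategory C] [UnitaryCategory C]
  [UnitaryFusionCategory C]
  {M : Type u'} [Category.{v'} M] [Abelian M] [Linear ℂ M] [UnitaryCategory M]
  [MonoidalLeftAction C M] [UnitaryModuleCategory C M]

namespace BalancedPairing

variable {X Y : C} {d : ℝ}

lemma action_zag (P : BalancedPairing X Y d) (m : M) :
    Y ⊴ₗ ((λₗ[C] m).inv ≫ P.coev ⊵ₗ m ≫ (αₗ X Y m).hom) ≫ (αₗ Y X (Y ⊙ₗ m)).inv ≫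
      P.ev ⊵ₗ (Y ⊙ₗ m) ≫ (λₗ[C] (Y ⊙ₗ m)).hom = 𝟙 (Y ⊙ₗ m) := by
  have e1 : Y ⊴ₗ (λₗ[C] m).inv = (ρ_ Y).inv ⊵ₗ m ≫ (αₗ Y (𝟙_ C) m).hom := by
    rw [← cancel_mono (Y ⊴ₗ (λₗ[C] m).hom), Category.assoc,
      ← MonoidalLeftAction.rightUnitor_actionHom]
    simp only [MonoidalLeftAction.inv_hom_actionHomLeft, MonoidalLeftAction.actionHomRight_inv_hom]
  have e2 : Y ⊴ₗ (αₗ X Y m).hom ≫ (αₗ Y X (Y ⊙ₗ m)).inv ≫ (αₗ (Y ⊗ X) Y m).inv =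
      (αₗ Y (X ⊗ Y) m).inv ≫ (α_ Y X Y).inv ⊵ₗ m := by
    rw [← cancel_mono (αₗ (Y ⊗ X) Y m).hom, ← cancel_mono (αₗ Y X (Y ⊙ₗ m)).hom]
    simp only [Category.assoc, Iso.inv_hom_id, Category.comp_id,
      ← MonoidalLeftAction.associator_actionHom, MonoidalLeftAction.inv_hom_actionHomLeft_assoc,
      Iso.inv_hom_id_assoc]
  have h : (ρ_ Y).inv ≫ Y ◁ P.coev ≫ (α_ Y X Y).inv ≫ P.ev ▷ Y ≫ (λ_ Y).hom = 𝟙 Y := by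
    have := P.zag
    rw [← cancel_epi (ρ_ Y).inv, ← cancel_mono (λ_ Y).hom] at this
    simpa using this
  have h' := congrArg (fun g => g ⊵ₗ m) h
  simp only [MonoidalLeftAction.comp_actionHomLeft, MonoidalLeftAction.id_actionHomLeft,
    MonoidalLeftAction.whiskerLeft_actionHomLeft, MonoidalLeftAction.leftUnitor_actionHom,
    Category.assoc] at h'
  simp only [MonoidalLeftAction.actionHomRight_comp, MonoidalLeftAction.actionHomLeft_action,
    Category.assoc]
  rw [e1, ← h', Category.assoc, reassoc_of% e2]

/-- Moving the strand of `Y` across an action. -/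
def actionBend (P : BalancedPairing X Y d) (m m' : M) : (Y ⊙ₗ m ⟶ m') →ₗ[ℂ] (m ⟶ X ⊙ₗ m') where
  toFun g := ((λₗ[C] m).inv ≫ P.coev ⊵ₗ m ≫ (αₗ X Y m).hom) ≫ X ⊴ₗ g
  map_add' g g' := by simp only [actionHomRight_add, Preadditive.comp_add]
  map_smul' c g := by simp only [actionHomRight_smul, Linear.comp_smul, RingHom.id_apply]

lemma actionBend_comp (P : BalancedPairing X Y d) {m m' : M} (g : Y ⊙ₗ m ⟶ m') :
    Y ⊴ₗ P.actionBend m m' g ≫ (αₗ Y X m').inv ≫ P.ev ⊵ₗ m' ≫ (λₗ[C] m').hom = g := by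
  have h := P.action_zag m
  have e : Y ⊴ₗ X ⊴ₗ g ≫ (αₗ Y X m').inv ≫ P.ev ⊵ₗ m' ≫ (λₗ[C] m').hom =
      (αₗ Y X (Y ⊙ₗ m)).inv ≫ P.ev ⊵ₗ (Y ⊙ₗ m) ≫ (λₗ[C] (Y ⊙ₗ m)).hom ≫ g := by
    rw [MonoidalLeftAction.actionUnitIso_hom_naturality,
      ← MonoidalLeftAction.action_exchange_assoc]
    simp
  rw [actionBend, LinearMap.coe_mk, AddHom.coe_mk, MonoidalLeftAction.actionHomRight_comp,
    Category.assoc, e]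
  conv_rhs => rw [← Category.id_comp g, ← h]
  simp only [Category.assoc]

lemma finrank_action_le (P : BalancedPairing X Y d) (m m' : M) :
    Module.finrank ℂ (Y ⊙ₗ m ⟶ m') ≤ Module.finrank ℂ (X ⊙ₗ m' ⟶ m) := by
  rw [finrank_hom_dag (X ⊙ₗ m')]
  refine LinearMap.finrank_le_finrank_of_injective (f := P.actionBend m m') fun g g' h => ?_
  rw [← P.actionBend_comp g, h, P.actionBend_comp g']

lemma finrank_action (P : BalancedPairing X Y d) (m m' : M) :
    Module.finrank ℂ (Y ⊙ₗ m ⟶ m') = Module.finrank ℂ (X ⊙ₗ m' ⟶ m) :=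
  le_antisymm (P.finrank_action_le m m') (P.symm.finrank_action_le m' m)

end BalancedPairing

variable (M) in
/-- The action of `X` as an endofunctor of `M`. -/
def actionFunctor (X : C) : M ⥤ M where
  obj m := X ⊙ₗ m
  map f := X ⊴ₗ f

variable (C) in
/-- The functor `X ↦ X ⊙ₗ m`. -/
def orbitFunctor (m : M) : C ⥤ M where
  obj X := X ⊙ₗ m
  map f := f ⊵ₗ m

instance (X : C) : (actionFunctor M X).Additive where
  map_add := actionHomRight_add _ _ _

instance (X : C) : (actionFunctor M X).Linear ℂ where
  map_smul _ _ := actionHomRight_smul _ _ _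

instance (m : M) : (orbitFunctor C m).Additive where
  map_add := add_actionHomLeft _ _ _

instance (m : M) : (orbitFunctor C m).Linear ℂ where
  map_smul _ _ := smul_actionHomLeft _ _ _

variable {ι : Type*} [Fintype ι] {x : ι → C} {κ : Type*} [Fintype κ] {m : κ → M}

lemma moduleFusionMatrix_mul (hx : IsSimpleList x) (hm : IsSimpleList m) (i j : ι) :
    moduleFusionMatrix m (x i) * moduleFusionMatrix m (x j) =
      ∑ p, (fusionMatrix x (x i) p j) • moduleFusionMatrix m (x p) := by
  refine Matrix.ext fun l k => ?_
  have h1 : Module.finrank ℂ (x i ⊙ₗ x j ⊙ₗ m k ⟶ m l) =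
      ∑ q, Module.finrank ℂ (x j ⊙ₗ m k ⟶ m q) * Module.finrank ℂ (x i ⊙ₗ m q ⟶ m l) :=
    finrank_hom_obj hm (actionFunctor M (x i)) (x j ⊙ₗ m k) (m l)
  have h2 : Module.finrank ℂ ((x i ⊗ x j) ⊙ₗ m k ⟶ m l) =
      ∑ p, Module.finrank ℂ (x i ⊗ x j ⟶ x p) * Module.finrank ℂ (x p ⊙ₗ m k ⟶ m l) :=
    finrank_hom_obj hx (orbitFunctor C (m k)) (x i ⊗ x j) (m l)
  have h3 : Module.finrank ℂ ((x i ⊗ x j) ⊙ₗ m k ⟶ m l) =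
      Module.finrank ℂ (x i ⊙ₗ x j ⊙ₗ m k ⟶ m l) :=
    (Linear.homCongr ℂ (αₗ (x i) (x j) (m k)) (Iso.refl (m l))).finrank_eq
  rw [h3, h1] at h2
  rw [Matrix.mul_apply, Matrix.sum_apply]
  simp only [Matrix.smul_apply, moduleFusionMatrix, fusionMatrix, Matrix.of_apply, smul_eq_mul]
  rw [Finset.sum_congr rfl fun q _ => mul_comm _ _]
  exact_mod_cast h2

lemma moduleFusionMatrix_unit [DecidableEq κ] (hm : IsSimpleList m) {X : C} (e : X ≅ 𝟙_ C) :
    moduleFusionMatrix m X = 1 := by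
  let _ := hm.simple
  refine Matrix.ext fun l k => ?_
  let f : X ⊙ₗ m k ≅ m k := (orbitFunctor C (m k)).mapIso e ≪≫ λₗ[C] (m k)
  have h : Module.finrank ℂ (X ⊙ₗ m k ⟶ m l) = Module.finrank ℂ (m k ⟶ m l) :=
    (Linear.homCongr ℂ f (Iso.refl (m l))).finrank_eq
  rw [moduleFusionMatrix, Matrix.of_apply, h, Matrix.one_apply]
  split_ifs with hlk
  · subst hlk
    rw [finrank_endomorphism_simple_eq_one]
    simp
  · have : Subsingleton (m k ⟶ m l) := subsingleton_of_forall_eq 0 fun g =>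
      hom_eq_zero_of_not_iso (fun hi => hlk (hm.irredundant _ _ hi).symm) g
    rw [Module.finrank_zero_of_subsingleton]
    simp

lemma isHermitian_sum_kroneckerPow (hx : IsSimpleList x) (m : κ → M) (n : ℕ) :
    (∑ j, ((quantumDim (x j) ^ (-(n : ℤ) + 2) : ℝ) : ℂ) •
      kroneckerPow (moduleFusionMatrix m (x j)) n).IsHermitian := by
  ext a b
  rw [Matrix.conjTranspose_apply, Matrix.sum_apply, Matrix.sum_apply, star_sum,
    ← (dualIdx_involutive hx).bijective.sum_comp]
  refine Finset.sum_congr rfl fun j _ => ?_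
  simp only [Matrix.smul_apply, kroneckerPow, Matrix.of_apply, moduleFusionMatrix, smul_eq_mul,
    quantumDim_dualIdx, star_mul', star_prod, (dualPairing hx j).finrank_action]
  simp

end ModuleCategories

section KroneckerPowers

variable {ι κ : Type*} [Fintype ι] [Fintype κ]

/-- The entrywise product of matrices `A i`, indexed by tuples. -/
def kroneckerProd {n : ℕ} (A : Fin n → Matrix κ κ ℂ) : Matrix (Fin n → κ) (Fin n → κ) ℂ :=
  Matrix.of fun a b => ∏ i, A i (a i) (b i)

lemma kroneckerProd_mul {n : ℕ} (A B : Fin n → Matrix κ κ ℂ) :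
    kroneckerProd A * kroneckerProd B = kroneckerProd fun i => A i * B i := by
  ext a b
  simp only [kroneckerProd, Matrix.mul_apply, Matrix.of_apply, ← Finset.prod_mul_distrib]
  rw [Finset.prod_univ_sum, Fintype.piFinset_univ]

lemma kroneckerProd_sum {n : ℕ} (c : Fin n → ι → ℂ) (A : ι → Matrix κ κ ℂ) :
    kroneckerProd (fun i => ∑ p, c i p • A p) =
      ∑ P : Fin n → ι, (∏ i, c i (P i)) • kroneckerProd (fun i => A (P i)) := by
  ext a b
  simp only [kroneckerProd, Matrix.of_apply, Matrix.sum_apply, Matrix.smul_apply, smul_eq_mul,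
    ← Finset.prod_mul_distrib]
  rw [Finset.prod_univ_sum, Fintype.piFinset_univ]

lemma kroneckerProd_one [DecidableEq κ] (n : ℕ) :
    kroneckerProd (fun _ : Fin n => (1 : Matrix κ κ ℂ)) = 1 := by
  ext a b
  simp only [kroneckerProd, Matrix.of_apply, Matrix.one_apply, Finset.prod_ite_zero,
    Finset.prod_const_one, funext_iff, Finset.mem_univ, true_imp_iff]

open Matrix in
/-- Positivity in the regular representation implies positivity in every representation in which
the matrix is Hermitian. -/
lemma posSemidef_sum_kroneckerPow (n : ℕ) (w : ι → ℂ) (N : ι → Matrix ι ι ℂ) (A : ι → Matrix κ κ ℂ)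
    (hN : (∑ j, w j • kroneckerPow (N j) n).PosSemidef)
    (hA : (∑ j, w j • kroneckerPow (A j) n).IsHermitian)
    (hmul : ∀ i j, A i * A j = ∑ p, N i p j • A p)
    [DecidableEq κ] {e : ι} (he : A e = 1) :
    (∑ j, w j • kroneckerPow (A j) n).PosSemidef := by
  classical
  set Y := ∑ j, w j • kroneckerPow (A j) n with hY
  set R := ∑ j, w j • kroneckerPow (N j) n with hR
  rw [hA.posSemidef_iff_eigenvalues_nonneg]
  intro q
  set μ := hA.eigenvalues q
  set v : (Fin n → κ) → ℂ := ⇑(hA.eigenvectorBasis q)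
  have hv : Y *ᵥ v = (μ : ℂ) • v := by
    simpa using! hA.mulVec_eigenvectorBasis q
  have hv0 : star v ⬝ᵥ v = 1 := by
    have h := inner_self_eq_norm_sq_to_K (𝕜 := ℂ) (hA.eigenvectorBasis q)
    rw [hA.eigenvectorBasis.orthonormal.1 q, EuclideanSpace.inner_eq_star_dotProduct,
      dotProduct_comm] at h
    simpa using! h
  let B : (Fin n → ι) → Matrix (Fin n → κ) (Fin n → κ) ℂ := fun J => kroneckerProd fun i => A (J i)
  have hB : ∀ J, Y * B J = ∑ P, R P J • B P := by
    intro J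
    have : ∀ j, kroneckerPow (A j) n * B J =
        ∑ P : Fin n → ι, kroneckerPow (N j) n P J • B P := by
      intro j
      calc _ = kroneckerProd fun i => A j * A (J i) := kroneckerProd_mul _ _
        _ = _ := by
          simp only [hmul]
          exact kroneckerProd_sum _ _
    simp only [hY, hR, Finset.sum_mul, Matrix.smul_mul, this, Matrix.sum_apply, Matrix.smul_apply,
      Finset.sum_smul, Finset.smul_sum, smul_smul, smul_eq_mul]
    exact Finset.sum_comm
  let T : (Fin n → ι) → ℂ := fun J => star v ⬝ᵥ (B J *ᵥ v)
  have hT : ∀ J, ∑ P, T P * R P J = μ * T J := by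
    intro J
    have h1 : star v ⬝ᵥ ((Y * B J) *ᵥ v) = μ * T J := by
      have : star v ᵥ* Y = (μ : ℂ) • star v := by
        rw [← hA.eq, ← star_mulVec, hv, star_smul]
        simp
      rw [← mulVec_mulVec, dotProduct_mulVec, this, smul_dotProduct, smul_eq_mul]
    rw [← h1, hB, Matrix.sum_mulVec, dotProduct_sum]
    refine Finset.sum_congr rfl fun P _ => ?_
    rw [smul_mulVec, dotProduct_smul, smul_eq_mul, mul_comm]
  have h2 := hN.dotProduct_mulVec_nonneg (star T)
  have h3 : star (star T) ⬝ᵥ (R *ᵥ star T) = μ * ∑ J, T J * star (T J) := by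
    rw [star_star, dotProduct_mulVec, dotProduct, Finset.mul_sum]
    refine Finset.sum_congr rfl fun J _ => ?_
    rw [← mul_assoc, ← hT]
    rfl
  have hTe : T (fun _ => e) = 1 := by
    simp only [T, B, he, kroneckerProd_one, one_mulVec, hv0]
  have h4 : ∑ J, T J * star (T J) = ((∑ J, ‖T J‖ ^ 2 : ℝ) : ℂ) := by
    push_cast
    exact Finset.sum_congr rfl fun J _ => Complex.mul_conj' _
  rw [h3, h4] at h2
  have h5 : 0 ≤ μ * ∑ J, ‖T J‖ ^ 2 := by exact_mod_cast h2
  have h6 : 0 < ∑ J, ‖T J‖ ^ 2 :=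
    Finset.sum_pos' (fun _ _ => by positivity) ⟨fun _ => e, Finset.mem_univ _, by simp [hTe]⟩
  exact nonneg_of_mul_nonneg_left h5 h6

end KroneckerPowers

lemma posSemidef_fusion {C : Type u} [Category.{v} C] [Abelian C] [Linear ℂ C] [MonoidalCategory C]
    [MonoidalPreadditive C] [MonoidalLinear ℂ C] [RigidCategory C] [UnitaryCategory C]
    [UnitaryFusionCategory C]
    {ι : Type*} [Fintype ι] {x : ι → C} (hx : IsSimpleList x) (n : ℕ) :
    (∑ j, ((quantumDim (x j) ^ (-(n : ℤ) + 2) : ℝ) : ℂ) •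
      kroneckerPow (fusionMatrix x (x j)) n).PosSemidef := by
  have : UnitaryModuleCategory C C :=
    { add_actionHomLeft := fun f g m => by simp
      smul_actionHomLeft := fun c f m => by simp
      actionHomRight_add := fun X _ _ f g => by simp
      actionHomRight_smul := fun X _ _ c f => by simp
      dag_actionHomLeft := fun f m => dag_whiskerRight f m
      dag_actionHomRight := fun X _ _ f => dag_whiskerLeft X f
      dag_actionAssocIso := UnitaryFusionCategory.dag_associator
      dag_actionUnitIso := UnitaryFusionCategory.dag_leftUnitor }
  refine .of_dotProduct_mulVec_nonneg (isHermitian_sum_kroneckerPow hx x n) fun c => ?_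
  convert sum_conj_mul_nonneg hx n c using 1
  simp only [dotProduct, Matrix.mulVec, Finset.mul_sum, ← mul_assoc, Matrix.sum_apply,
    Matrix.smul_apply, kroneckerPow, fusionMatrix, Matrix.of_apply, smul_eq_mul]
  rfl

theorem mainTheorem10
    (C : Type u) [Category.{v} C] [Abelian C] [Linear ℂ C] [MonoidalCategory C]
    [MonoidalPreadditive C] [MonoidalLinear ℂ C] [RigidCategory C] [UnitaryCategory C]
    [UnitaryFusionCategory C]
    {ι : Type*} [Fintype ι] (x : ι → C) (hx : IsSimpleList x) (n : ℕ) :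
    (∑ j, ((quantumDim (x j) ^ (-(n : ℤ) + 2) : ℝ) : ℂ) •
      kroneckerPow (fusionMatrix x (x j)) n).PosSemidef ∧
    ∀ (M : Type u') [Category.{v'} M] [Abelian M] [Linear ℂ M] [UnitaryCategory M]
      [MonoidalLeftAction C M] [UnitaryModuleCategory C M]
      {κ : Type*} [Fintype κ] (m : κ → M), IsSimpleList m →
      (∑ j, ((quantumDim (x j) ^ (-(n : ℤ) + 2) : ℝ) : ℂ) •
        kroneckerPow (moduleFusionMatrix m (x j)) n).PosSemidef := by
  classical
  refine ⟨posSemidef_fusion hx n, ?_⟩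
  intro M _ _ _ _ _ _ κ _ m hm
  obtain ⟨e, ⟨φ⟩⟩ := hx.complete (𝟙_ C) inferInstance
  exact posSemidef_sum_kroneckerPow n _ (fun j => fusionMatrix x (x j)) _ (posSemidef_fusion hx n)
    (isHermitian_sum_kroneckerPow hx m n) (moduleFusionMatrix_mul hx hm)
    (moduleFusionMatrix_unit hm φ.symm)
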